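/- Let $R \in (0, \infty]$, let $a(dt)$ be a non-negative, locally finite measure on $[0, R)$ (an atom at $0$ is allowed), and let $b$ be a Borel, real-valued function on $[0, R)$ such that $b^2$ is locally integrable on $[0, R)$ and $\tilde a(dt) = a(dt) - (b(t))^2\,dt$ is a non-negative measure on $[0, R)$. Write $B(t) = \int_0^t b(s)\,ds$. For $\xi > 0$ consider the equation $$\varphi''(dt) = \xi^2 \varphi(t)\, a(dt) - 2 i \xi\, b(t) \varphi'(t)\, dt \qquad \text{on } [0, R). \tag{1}$$ A solution is a locally absolutely continuous function $\varphi : [0, R) \to \mathbb{C}$ whose derivative is almost everywhere equal to a left-continuous function of locally bounded variation on $[0, R)$, denoted by $\varphi'$, such that the measure $\varphi''(dt)$ on $[0, R)$ given by $\varphi''([s, t)) = \varphi'(t) - \varphi'(s)$ for $0 \le s \le t < R$ is equal to the right-hand side of (1); in particular, $\varphi'(0^+) - \varphi'(0) = \xi^2 a(\{0\}) \varphi(0)$. (a) For every $\xi > 0$ there is a unique solution $\varphi_\xi$ of (1) such that $\varphi_\xi(0) = 1$ and $\varphi_\xi$ is bounded if $R = \infty$, while $\varphi_\xi(R^-) =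 0$ if $R < \infty$. If $R = \infty$, then $|\psi(t)| \to \infty$ as $t \to \infty$ for every solution $\psi$ of (1) which is not a constant multiple of $\varphi_\xi$. If $R < \infty$, then every solution of (1) which is not a constant multiple of $\varphi_\xi$ is bounded away from zero in some left neighbourhood of $R$. (b) Let $k(\xi) = -\varphi_\xi'(0)$ for $\xi > 0$. Then $k$ extends to a Rogers function; that is, $k$ has a holomorphic extension to the right complex half-plane $\{\xi \in \mathbb{C} : \operatorname{Re} \xi > 0\}$, and this extension satisfies $\operatorname{Re}(k(\xi)/\xi) \ge 0$ whenever $\operatorname{Re} \xi > 0$. (c) For every $\xi > 0$ the function $|\varphi_\xi|^2$ is positive, non-increasing and convex on $[0, R)$, and $|\varphi_\xi'|$ is non-increasing on $[0, R)$. Furthermore, if $\tilde\varphi_\xi(t) = e^{i \xi B(t)} \varphi_\xi(t)$, then for every $t \in [0, R)$ we have $$\xi^2 \int_{[t, R)} |\tilde\varphi_\xi(s)|^2\, \tilde a(ds) + \int_t^R |\tilde\varphi_\xi'(s)|^2\, ds \le \min\Bigl(\operatorname{Re} k(\xi), \frac{2}{t}\Bigr),$$ where $2/0 = \infty$. In particular,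 $|\tilde\varphi_\xi'|^2$ is integrable on $[0, R)$. -/

import Mathlib

open MeasureTheory Set Filter Topology

namespace RogersODE

noncomputable section

/-- The half-open interval `[0, R)`, where `R ∈ (0, ∞]` is an extended real number. -/
def dom (R : EReal) : Set ℝ := {t : ℝ | 0 ≤ t ∧ (t : EReal) < R}

/-- The measure `b(t)² dt` on `[0, R)`. -/
def sqMeasure (R : EReal) (b : ℝ → ℝ) : Measure ℝ :=
  (volume.restrict (dom R)).withDensity fun t => ENNReal.ofReal (b t ^ 2)

/-- Admissible coefficients on `[0, R)`. The values of `a` and `b` outside `[0, R)` are irrelevant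
here and in everything below. An atom of `a` at `0` is allowed. -/
structure Coefficients (R : EReal) (a : Measure ℝ) (b : ℝ → ℝ) : Prop where
  R_pos : 0 < R
  /-- `a` is locally finite on `[0, R)`. -/
  a_finite : ∀ t ∈ dom R, a (Icc 0 t) < ⊤
  /-- `b` is a Borel function on `[0, R)`. -/
  b_measurable : Measurable ((dom R).domRestrict b)
  /-- `b²` is locally integrable on `[0, R)`. -/
  b_sq_integrable : ∀ t ∈ dom R, IntegrableOn (fun s => b s ^ 2) (Icc 0 t)
  /-- `a(dt) - b(t)² dt` is non-negative on `[0, R)`. -/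
  sq_le : sqMeasure R b ≤ a.restrict (dom R)

/-- The measure `ã(dt) = a(dt) - b(t)² dt` on `[0, R)`. -/
def tildeA (R : EReal) (a : Measure ℝ) (b : ℝ → ℝ) : Measure ℝ :=
  a.restrict (dom R) - sqMeasure R b

/-- `B(t) = ∫₀ᵗ b(s) ds`. -/
def primB (b : ℝ → ℝ) (t : ℝ) : ℝ := ∫ s in (0 : ℝ)..t, b s

/-- `φ̃(t) = exp(i ξ B(t)) φ(t)`. -/
def tildePhi (b : ℝ → ℝ) (ξ : ℝ) (φ : ℝ → ℂ) (t : ℝ) : ℂ :=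
  Complex.exp (Complex.I * ξ * primB b t) * φ t

/-- `φ` is a solution on `[0, R)` of `φ''(dt) = ξ² φ(t) a(dt) - 2 i ξ b(t) φ'(t) dt`, and `dφ` is
the left-continuous version of its derivative `φ'`.

The second derivative `φ''(dt)` is the complex Lebesgue–Stieltjes measure on `[0, R)` of the
left-continuous function `φ'` of locally bounded variation, that is, the measure which assigns the
mass `φ'(t) - φ'(s)` to `[s, t)`; it has an atom of mass `φ'(0+) - φ'(0)` at `0`. Two locally finite
complex measures on `[0, R)` agree if and only if they agree on all the intervals `[s, t)`. -/
structure IsSolution (R : EReal) (a : Measure ℝ) (b : ℝ → ℝ) (ξ : ℝ) (φ dφ : ℝ → ℂ) : Prop where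
  /-- `φ` is locally absolutely continuous on `[0, R)`. -/
  absCont : ∀ t ∈ dom R, AbsolutelyContinuousOnInterval φ 0 t
  /-- `dφ` is the derivative of `φ`. -/
  hasDeriv : ∀ᵐ t ∂(volume.restrict (dom R)), HasDerivAt φ (dφ t) t
  /-- `dφ` is left-continuous on `[0, R)` (this says nothing at `0`). -/
  leftCont : ∀ t ∈ dom R, ContinuousWithinAt dφ (Icc 0 t) t
  /-- The distributional derivative of `dφ` is a locally finite measure on `[0, R)`. -/
  boundedVar : LocallyBoundedVariationOn dφ (dom R)
  /-- Equality of the measures `φ''(dt)` and `ξ² φ(t) a(dt) - 2 i ξ b(t) φ'(t) dt`. -/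
  equation : ∀ s ∈ dom R, ∀ t ∈ dom R, s ≤ t →
    dφ t - dφ s = (ξ : ℂ) ^ 2 * (∫ u in Ico s t, φ u ∂a)
      - 2 * Complex.I * ξ * (∫ u in Ico s t, (b u : ℂ) * dφ u)

/-- The boundary condition at `R`: boundedness if `R = ∞`, and `φ(R⁻) = 0` if `R < ∞`. -/
def VanishesOrBounded (R : EReal) (φ : ℝ → ℂ) : Prop :=
  (R = ⊤ → ∃ C : ℝ, ∀ t ∈ dom R, ‖φ t‖ ≤ C) ∧
  (∀ r : ℝ, R = (r : EReal) → Tendsto φ (𝓝[<] r) (𝓝 0))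

/-- `φ` diverges to infinity at `∞` if `R = ∞`, and it is bounded away from zero in some left
neighbourhood of `R` if `R < ∞`. -/
def DivergesOrAwayFromZero (R : EReal) (φ : ℝ → ℂ) : Prop :=
  (R = ⊤ → Tendsto (fun t => ‖φ t‖) atTop atTop) ∧
  (∀ r : ℝ, R = (r : EReal) → ∃ δ > 0, ∀ᶠ t in 𝓝[<] r, δ ≤ ‖φ t‖)

/-- `φ`, with derivative `dφ`, is a solution with `φ(0) = 1` that satisfies the boundary condition
at `R`. -/
def IsPrincipalSolution (R : EReal) (a : Measure ℝ) (b : ℝ → ℝ) (ξ : ℝ) (φ dφ : ℝ → ℂ) : Prop :=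
  IsSolution R a b ξ φ dφ ∧ φ 0 = 1 ∧ VanishesOrBounded R φ

/-- `k` is a Rogers function on the right complex half-plane. -/
def IsRogers (k : ℂ → ℂ) : Prop :=
  DifferentiableOn ℂ k {z : ℂ | 0 < z.re} ∧ ∀ z : ℂ, 0 < z.re → 0 ≤ (k z / z).re

/-- `ξ² ∫_{[t, R)} |φ̃(s)|² ã(ds) + ∫_t^R |φ̃'(s)|² ds`, with values in `[0, ∞]`. The function `φ̃`
is locally absolutely continuous, so that its pointwise derivative exists almost everywhere. -/
def energy (R : EReal) (a : Measure ℝ) (b : ℝ → ℝ) (ξ : ℝ) (φ : ℝ → ℂ) (t : ℝ) : ENNReal :=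
  ENNReal.ofReal (ξ ^ 2) *
      ∫⁻ s in dom R ∩ Ici t, ENNReal.ofReal (‖tildePhi b ξ φ s‖ ^ 2) ∂(tildeA R a b)
    + ∫⁻ s in dom R ∩ Ici t, ENNReal.ofReal (‖deriv (tildePhi b ξ φ) s‖ ^ 2)

/-- If `ν ≤ μ` and `ν` is `σ`-finite, then `μ - ν` is the genuine difference of measures. -/
theorem sub_add_cancel_of_sigmaFinite {μ ν : Measure ℝ} [SigmaFinite ν] (hle : ν ≤ μ) :
    μ - ν + ν = μ := by
  have key : ∀ n, (μ - ν + ν).restrict (spanningSets ν n) = μ.restrict (spanningSets ν n) := by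
    intro n
    have hn := measurableSet_spanningSets ν n
    have : IsFiniteMeasure (ν.restrict (spanningSets ν n)) :=
      ⟨by simpa using measure_spanningSets_lt_top ν n⟩
    rw [Measure.restrict_add, Measure.restrict_sub_eq_restrict_sub_restrict hn]
    exact Measure.sub_add_cancel_of_le (Measure.restrict_mono Subset.rfl hle)
  have := Measure.restrict_iUnion_congr.2 key
  simpa only [iUnion_spanningSets, Measure.restrict_univ] using this

/-- For admissible coefficients, `ã(dt) + b(t)² dt = a(dt)` on `[0, R)`. -/
theorem tildeA_add_sqMeasure {R : EReal} {a : Measure ℝ} {b : ℝ → ℝ} (h : Coefficients R a b) :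
    tildeA R a b + sqMeasure R b = a.restrict (dom R) := by
  have : SigmaFinite (sqMeasure R b) := by
    unfold sqMeasure
    exact SigmaFinite.withDensity_ofReal _
  exact sub_add_cancel_of_sigmaFinite h.sq_le

end

end RogersODE

namespace RogersODE

/-! ### Absolutely continuous functions -/

/-! Put `w = exp(2iξB) φ'`. The drift term disappears and the equation becomes the integral system
`φ' = exp(-2iξB) w`, `dw = ξ² exp(2iξB) φ da`, which a Volterra series solves with entire dependence
on `ξ`.

Everything else rests on one identity, `IntegralSolution.energy_identity`. For `Re ξ > 0` the flux
`Re(exp(-2 Im ξ B) φ̄ φ' / ξ)` has differential `Re ξ · exp(-2 Im ξ B) |φ|² dã + (Re ξ / |ξ|²)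
|φ̃'|² dt`, which is non-negative because `ã` is. This has two uses.

For complex `ξ`, a solution that vanishes at both `0` and `T` is trivial. Hence the solution with
value `1` at `0` that vanishes at `T` exists, and its coefficient `k_T = -φ'(0)` is holomorphic. Its
flux vanishes at `T`, so the flux at `0`, which is `-Re(k_T/ξ)`, is non-positive: `k_T` is a Rogers
function.

For real `ξ` the flux is the derivative of `|φ|²` divided by `2ξ`, so `|φ|²` is convex for every
solution. A convex function that increases anywhere keeps growing at least linearly. This gives the
alternative at `R`, the monotonicity of `|φ|²` under the boundary condition, and uniqueness.

Existence comes from `T ↑ R` (`exists_rogers`). The functions `k_T/ξ` map the half-plane to the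
closed half-plane and are bounded at one point, so they converge along an ultrafilter. The convex
bound `|φ_T(t)|² ≤ 1 - t/T` passes to the limit and yields the boundary condition.

The energy bound is the identity on `[t, T]`: the flux at `T` is non-positive and may be dropped,
and monotonicity of the flux bounds its value at `t`. Finally `|φ'| = |w|`, and `w` makes an obtuse
angle with its own increments when the flux is non-positive. -/

theorem AbsolutelyContinuousOnInterval.of_dist_le {X Y : Type*} [PseudoMetricSpace X]
    [PseudoMetricSpace Y] {f : ℝ → X} {g : ℝ → Y} {c d K : ℝ}
    (hg : AbsolutelyContinuousOnInterval g c d)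
    (h : ∀ x ∈ uIcc c d, ∀ y ∈ uIcc c d, dist (f x) (f y) ≤ K * dist (g x) (g y)) :
    AbsolutelyContinuousOnInterval f c d := by
  unfold AbsolutelyContinuousOnInterval at hg ⊢
  refine squeeze_zero' ?_ ?_ (by simpa using hg.const_mul K)
  · exact Eventually.of_forall fun _ => Finset.sum_nonneg fun i hi => dist_nonneg
  rw [eventually_inf_principal]
  filter_upwards with E hE
  rw [Finset.mul_sum]
  exact Finset.sum_le_sum fun i hi => h _ (hE.1 i hi).1 _ (hE.1 i hi).2

theorem absolutelyContinuousOnInterval_integral {g : ℝ → ℂ} {c d : ℝ}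
    (hg : IntervalIntegrable g volume c d) :
    AbsolutelyContinuousOnInterval (fun t => ∫ s in c..t, g s) c d := by
  refine AbsolutelyContinuousOnInterval.of_dist_le (K := 1)
    (hg.norm.absolutelyContinuousOnInterval_intervalIntegral (c := c) left_mem_uIcc) ?_
  intro x hx y hy
  have h1 : IntervalIntegrable g volume c x := hg.mono_set (uIcc_subset_uIcc_left hx)
  have h2 : IntervalIntegrable g volume c y := hg.mono_set (uIcc_subset_uIcc_left hy)
  rw [one_mul, dist_eq_norm, Real.dist_eq, intervalIntegral.integral_interval_sub_left h1 h2,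
    intervalIntegral.integral_interval_sub_left h1.norm h2.norm]
  exact intervalIntegral.norm_integral_le_abs_integral_norm

/-- `G` is a primitive on `[0, T]` of the integrable function `g`. -/
structure HasPrim (G g : ℝ → ℂ) (T : ℝ) : Prop where
  int : IntervalIntegrable g volume 0 T
  eq : ∀ t ∈ Icc 0 T, G t = G 0 + ∫ s in (0 : ℝ)..t, g s

variable {G g G₁ g₁ G₂ g₂ : ℝ → ℂ} {T : ℝ}

theorem IntervalIntegrable.mono_of_mem {g : ℝ → ℂ} (h : IntervalIntegrable g volume 0 T) {s t : ℝ}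
    (hs : s ∈ Icc 0 T) (ht : t ∈ Icc 0 T) : IntervalIntegrable g volume s t :=
  h.mono_set (by
    rw [uIcc_of_le (hs.1.trans hs.2)]
    exact uIcc_subset_Icc hs ht)

theorem HasPrim.sub_eq (h : HasPrim G g T) {s t : ℝ} (hs : s ∈ Icc 0 T) (ht : t ∈ Icc 0 T) :
    G t - G s = ∫ u in s..t, g u := by
  have h0 : (0 : ℝ) ∈ Icc 0 T := ⟨le_rfl, hs.1.trans hs.2⟩
  rw [h.eq t ht, h.eq s hs, add_sub_add_left_eq_sub,
    intervalIntegral.integral_interval_sub_left (IntervalIntegrable.mono_of_mem h.int h0 ht)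
      (IntervalIntegrable.mono_of_mem h.int h0 hs)]

theorem HasPrim.absCont (h : HasPrim G g T) (hT : 0 ≤ T) :
    AbsolutelyContinuousOnInterval G 0 T := by
  refine AbsolutelyContinuousOnInterval.of_dist_le (K := 1)
    (absolutelyContinuousOnInterval_integral h.int) ?_
  intro x hx y hy
  rw [uIcc_of_le hT] at hx hy
  rw [h.eq x hx, h.eq y hy, dist_add_left, one_mul]

theorem HasPrim.continuousOn (h : HasPrim G g T) (hT : 0 ≤ T) : ContinuousOn G (Icc 0 T) := by
  have := (h.absCont hT).continuousOn
  rwa [uIcc_of_le hT] at this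

theorem HasPrim.ae_hasDerivAt (h : HasPrim G g T) (hT : 0 ≤ T) :
    ∀ᵐ t, t ∈ Icc 0 T → HasDerivAt G (g t) t := by
  have h₁ : ∀ᵐ x : ℝ, x ≠ 0 := by simp [ae_iff, measure_singleton]
  have h₂ : ∀ᵐ x : ℝ, x ≠ T := by simp [ae_iff, measure_singleton]
  filter_upwards [h.int.ae_hasDerivAt_integral, h₁, h₂] with t ht h0 h1 htT
  have := (ht (by rwa [uIcc_of_le hT]) 0 left_mem_uIcc).const_add (G 0)
  refine this.congr_of_eventuallyEq ?_
  filter_upwards [Icc_mem_nhds (lt_of_le_of_ne htT.1 h0.symm) (lt_of_le_of_ne htT.2 h1)] with x hx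
  exact h.eq x hx

/-- The difference of `G` and the integral of `g` is absolutely continuous with derivative zero
almost everywhere, hence constant. This reduces the product and exponential rules to the pointwise
ones. -/
theorem HasPrim.of_absCont (hT : 0 ≤ T) (hG : AbsolutelyContinuousOnInterval G 0 T)
    (hg : IntervalIntegrable g volume 0 T) (hd : ∀ᵐ t, t ∈ Icc 0 T → HasDerivAt G (g t) t) :
    HasPrim G g T := by
  refine ⟨hg, ?_⟩
  obtain ⟨C, hC⟩ := (hG.sub (absolutelyContinuousOnInterval_integral hg)).const_of_ae_hasDerivAt_zero
    (by
      filter_upwards [hd, hg.ae_hasDerivAt_integral] with t h1 h2 ht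
      have := (h1 (by rwa [uIcc_of_le hT] at ht)).sub (h2 ht 0 left_mem_uIcc)
      rwa [sub_self] at this)
  rw [uIcc_of_le hT] at hC
  intro t ht
  have e0 := hC 0 ⟨le_rfl, hT⟩
  have et := hC t ht
  simp only [Pi.sub_apply, intervalIntegral.integral_same, sub_zero] at e0 et
  rw [e0, ← et]
  ring

theorem HasPrim.mul (hT : 0 ≤ T) (h₁ : HasPrim G₁ g₁ T) (h₂ : HasPrim G₂ g₂ T) :
    HasPrim (fun t => G₁ t * G₂ t) (fun t => g₁ t * G₂ t + G₁ t * g₂ t) T := by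
  have c1 := (h₁.absCont hT).continuousOn
  have c2 := (h₂.absCont hT).continuousOn
  refine HasPrim.of_absCont hT ((h₁.absCont hT).smul (h₂.absCont hT))
    ((h₁.int.mul_continuousOn c2).add (h₂.int.continuousOn_mul c1)) ?_
  filter_upwards [h₁.ae_hasDerivAt hT, h₂.ae_hasDerivAt hT] with t e1 e2 ht
  exact (e1 ht).mul (e2 ht)

theorem HasPrim.const_mul (h : HasPrim G g T) (c : ℂ) :
    HasPrim (fun t => c * G t) (fun t => c * g t) T := by
  refine ⟨h.int.const_mul c, fun t ht => ?_⟩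
  rw [intervalIntegral.integral_const_mul, h.eq t ht]
  ring

theorem HasPrim.star (h : HasPrim G g T) :
    HasPrim (fun t => (starRingEnd ℂ) (G t)) (fun t => (starRingEnd ℂ) (g t)) T := by
  have hint : IntervalIntegrable (fun t => (starRingEnd ℂ) (g t)) volume 0 T := by
    rw [intervalIntegrable_iff] at *
    have := h.int
    rw [intervalIntegrable_iff] at this
    exact (Complex.conjLIE.toContinuousLinearEquiv.toContinuousLinearMap).integrable_comp this
  refine ⟨hint, fun t ht => ?_⟩
  rw [h.eq t ht, map_add]
  congr 1
  simp only [intervalIntegral, map_sub, integral_conj]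

theorem HasPrim.cexp (hT : 0 ≤ T) (h : HasPrim G g T) :
    HasPrim (fun t => Complex.exp (G t)) (fun t => g t * Complex.exp (G t)) T := by
  have hc := h.continuousOn hT
  obtain ⟨M, hM⟩ := isCompact_Icc.exists_bound_of_continuousOn hc
  have hac : AbsolutelyContinuousOnInterval (fun t => Complex.exp (G t)) 0 T := by
    refine AbsolutelyContinuousOnInterval.of_dist_le (K := Real.exp M) (h.absCont hT) ?_
    intro x hx y hy
    rw [uIcc_of_le hT] at hx hy
    rw [dist_eq_norm, dist_eq_norm]
    -- The range of `G` lies in the ball of radius `M`, on which `exp` is Lipschitz with constant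
    -- `exp M`.
    refine Convex.norm_image_sub_le_of_norm_deriv_le (s := Metric.closedBall 0 M)
      (fun z _ => Complex.differentiable_exp z) ?_ (convex_closedBall 0 M)
      (by simpa using hM y hy) (by simpa using hM x hx)
    intro z hz
    rw [Complex.deriv_exp, Complex.norm_exp]
    exact Real.exp_le_exp.2 ((Complex.re_le_norm z).trans (by simpa using hz))
  refine HasPrim.of_absCont hT hac (h.int.mul_continuousOn ?_) ?_
  · rw [uIcc_of_le hT]
    exact Complex.continuous_exp.comp_continuousOn hc
  · filter_upwards [h.ae_hasDerivAt hT] with t e ht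
    have := (e ht).cexp
    rwa [mul_comm] at this

/-! ### Stieltjes integrals and integration by parts -/

theorem integrableOn_of_continuousOn {E : Type*} [NormedAddCommGroup E] {μ : Measure ℝ}
    (hμ : μ (Icc 0 T) < ⊤) {h : ℝ → E}
    (hh : ContinuousOn h (Icc 0 T)) : IntegrableOn h (Icc 0 T) μ := by
  obtain ⟨M, hM⟩ := isCompact_Icc.exists_bound_of_continuousOn hh
  have : IsFiniteMeasure (μ.restrict (Icc 0 T)) := ⟨by simpa using hμ⟩
  exact Integrable.of_bound (hh.aestronglyMeasurable measurableSet_Icc) M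
    ((ae_restrict_iff' measurableSet_Icc).2 (Eventually.of_forall hM))

theorem integrableOn_Ico_of_Icc {E : Type*} [NormedAddCommGroup E] {μ : Measure ℝ} {h : ℝ → E}
    (hh : IntegrableOn h (Icc 0 T) μ)
    {s t : ℝ} (hs : 0 ≤ s) (ht : t ≤ T) : IntegrableOn h (Ico s t) μ :=
  hh.mono_set fun _ hu => ⟨hs.trans hu.1, hu.2.le.trans ht⟩

theorem integral_Ico_sub {E : Type*} [NormedAddCommGroup E] [NormedSpace ℝ E] {μ : Measure ℝ}
    {h : ℝ → E} (hh : IntegrableOn h (Icc 0 T) μ)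
    {s t : ℝ} (hs : 0 ≤ s) (hst : s ≤ t) (ht : t ≤ T) :
    (∫ u in Ico 0 t, h u ∂μ) - ∫ u in Ico 0 s, h u ∂μ = ∫ u in Ico s t, h u ∂μ := by
  rw [← Ico_union_Ico_eq_Ico hs hst, setIntegral_union
    (Set.disjoint_left.2 fun x h1 h2 => absurd h1.2 (not_lt.2 h2.1)) measurableSet_Ico
    (integrableOn_Ico_of_Icc hh le_rfl (hst.trans ht)) (integrableOn_Ico_of_Icc hh hs ht)]
  abel

/-- Integration by parts: `d(G v) = G dv + g v dt` for `dv = h dμ` and `dG = g dt`. -/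
theorem HasPrim.mul_stieltjes (hG : HasPrim G g T) {μ : Measure ℝ} (hμ : μ (Icc 0 T) < ⊤)
    {h : ℝ → ℂ} (hh : IntegrableOn h (Icc 0 T) μ) {t : ℝ} (ht : t ∈ Icc 0 T) :
    IntervalIntegrable (fun s => g s * ∫ u in Ico 0 s, h u ∂μ) volume 0 t ∧
    G t * (∫ u in Ico 0 t, h u ∂μ) =
      (∫ u in Ico 0 t, G u * h u ∂μ) + ∫ s in (0 : ℝ)..t, g s * ∫ u in Ico 0 s, h u ∂μ := by
  have h0 : (0 : ℝ) ∈ Icc 0 T := ⟨le_rfl, ht.1.trans ht.2⟩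
  have hT := h0.2
  have hsub : Ico 0 t ⊆ Icc 0 T := fun u hu => ⟨hu.1, hu.2.le.trans ht.2⟩
  have : IsFiniteMeasure (μ.restrict (Ico 0 t)) :=
    ⟨by simpa using (measure_mono hsub).trans_lt hμ⟩
  have hgt : IntervalIntegrable g volume 0 t := IntervalIntegrable.mono_of_mem hG.int h0 ht
  have hgi : Integrable g (volume.restrict (Ioc 0 t)) :=
    (intervalIntegrable_iff_integrableOn_Ioc_of_le ht.1).1 hgt
  have hhi : Integrable h (μ.restrict (Ico 0 t)) := hh.mono_set hsub
  -- Fubini on the triangle `u < s`. The strict inequality matches the half-open `Ico 0 s`, so an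
  -- atom at `s` is not yet counted at time `s`.
  set D : Set (ℝ × ℝ) := {q | q.1 < q.2} with hD
  have hDm : MeasurableSet D := measurableSet_lt measurable_fst measurable_snd
  have hF : Integrable (D.indicator fun q : ℝ × ℝ => h q.1 * g q.2)
      ((μ.restrict (Ico 0 t)).prod (volume.restrict (Ioc 0 t))) := (hhi.mul_prod hgi).indicator hDm
  have inner1 : ∀ u ∈ Ico 0 t, (∫ s in Ioc 0 t, D.indicator (fun q : ℝ × ℝ => h q.1 * g q.2) (u, s))
      = h u * (G t - G u) := by
    intro u hu
    have e : (fun s => D.indicator (fun q : ℝ × ℝ => h q.1 * g q.2) (u, s))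
        = (Ioi u).indicator fun s => h u * g s := by
      ext s
      simp [indicator, hD]
    rw [e, setIntegral_indicator measurableSet_Ioi, integral_const_mul,
      hG.sub_eq (hsub hu) ht, intervalIntegral.integral_of_le hu.2.le]
    congr 3
    ext s
    simp only [mem_inter_iff, mem_Ioc, mem_Ioi]
    exact ⟨fun q => ⟨q.2, q.1.2⟩, fun q => ⟨⟨hu.1.trans_lt q.1, q.2⟩, q.1⟩⟩
  have inner2 : ∀ s ∈ Ioc 0 t, (∫ u in Ico 0 t, D.indicator (fun q : ℝ × ℝ => h q.1 * g q.2) (u, s) ∂μ)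
      = g s * ∫ u in Ico 0 s, h u ∂μ := by
    intro s hs
    have e : (fun u => D.indicator (fun q : ℝ × ℝ => h q.1 * g q.2) (u, s))
        = (Iio s).indicator fun u => g s * h u := by
      ext u
      simp [indicator, hD, mul_comm]
    rw [e, setIntegral_indicator measurableSet_Iio, integral_const_mul]
    congr 3
    ext u
    simp only [mem_inter_iff, mem_Ico, mem_Iio]
    exact ⟨fun q => ⟨q.1.1, q.2⟩, fun q => ⟨⟨q.1, q.2.trans_le hs.2⟩, q.2⟩⟩
  have hswap := integral_integral_swap (f := fun u s =>
    D.indicator (fun q : ℝ × ℝ => h q.1 * g q.2) (u, s)) hF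
  rw [setIntegral_congr_fun measurableSet_Ico inner1, setIntegral_congr_fun measurableSet_Ioc inner2]
    at hswap
  have hGh : Integrable (fun u => G u * h u) (μ.restrict (Ico 0 t)) := by
    obtain ⟨M, hM⟩ := isCompact_Icc.exists_bound_of_continuousOn (hG.continuousOn hT)
    refine hhi.bdd_mul (c := M) (((hG.continuousOn hT).mono hsub).aestronglyMeasurable
      measurableSet_Ico) ?_
    exact (ae_restrict_iff' measurableSet_Ico).2 (Eventually.of_forall fun u hu => hM u (hsub hu))
  refine ⟨?_, ?_⟩
  · rw [intervalIntegrable_iff_integrableOn_Ioc_of_le ht.1]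
    exact hF.integral_prod_right.congr
      ((ae_restrict_iff' measurableSet_Ioc).2 (Eventually.of_forall inner2))
  · rw [intervalIntegral.integral_of_le ht.1, ← hswap]
    have : (fun u => h u * (G t - G u)) = fun u => G t * h u - G u * h u := by
      ext u; ring
    rw [this, integral_sub (hhi.const_mul _) hGh, integral_const_mul]
    ring

theorem hasPrim_id : HasPrim (fun t => (t : ℂ)) (fun _ => 1) T :=
  ⟨intervalIntegrable_const, fun t _ => by simp⟩

theorem intervalIntegrable_stieltjes {μ : Measure ℝ} (hμ : μ (Icc 0 T) < ⊤)
    {h : ℝ → ℂ} (hh : IntegrableOn h (Icc 0 T) μ) (hT : 0 ≤ T) :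
    IntervalIntegrable (fun s => ∫ u in Ico 0 s, h u ∂μ) volume 0 T := by
  simpa using ((hasPrim_id (T := T)).mul_stieltjes hμ hh ⟨hT, le_rfl⟩).1

end RogersODE

namespace RogersODE

/-! ### The equation in terms of `w = exp(2 i ξ B) φ'` -/

/-- The function `exp(c B(t))`. -/
noncomputable def expB (b : ℝ → ℝ) (c : ℂ) (t : ℝ) : ℂ := Complex.exp (c * primB b t)

theorem expB_zero_right (b : ℝ → ℝ) (c : ℂ) : expB b c 0 = 1 := by
  simp [expB, primB]

theorem expB_mul (b : ℝ → ℝ) (c d : ℂ) (t : ℝ) : expB b c t * expB b d t = expB b (c + d) t := by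
  simp only [expB, ← Complex.exp_add]
  ring_nf

theorem expB_ne_zero (b : ℝ → ℝ) (c : ℂ) (t : ℝ) : expB b c t ≠ 0 := Complex.exp_ne_zero _

theorem expB_neg_mul_cancel (b : ℝ → ℝ) (c : ℂ) (t : ℝ) (z : ℂ) :
    expB b (-c) t * (expB b c t * z) = z := by
  rw [← mul_assoc, expB_mul]
  simp [expB]

theorem expB_mul_neg_cancel (b : ℝ → ℝ) (c : ℂ) (t : ℝ) (z : ℂ) :
    expB b c t * (expB b (-c) t * z) = z := by
  rw [← mul_assoc, expB_mul]
  simp [expB]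

/-- Coefficients on a compact interval `[0, T]`, where `α(dt) = a(dt) - b(t)² dt`. -/
structure LocalCoeff (a α : Measure ℝ) (b : ℝ → ℝ) (T : ℝ) : Prop where
  nonneg : 0 ≤ T
  finite : a (Icc 0 T) < ⊤
  b_int : IntervalIntegrable b volume 0 T
  sq_int : IntervalIntegrable (fun s => b s ^ 2) volume 0 T
  split : ∀ h : ℝ → ℝ, ContinuousOn h (Icc 0 T) → ∀ s ∈ Icc 0 T, ∀ t ∈ Icc 0 T, s ≤ t →
    IntegrableOn h (Ico s t) α ∧
      ∫ u in Ico s t, h u ∂a = (∫ u in Ico s t, h u ∂α) + ∫ u in s..t, b u ^ 2 * h u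

variable {a α : Measure ℝ} {b : ℝ → ℝ} {T : ℝ} {ξ : ℂ} {φ w : ℝ → ℂ}

theorem LocalCoeff.hasPrim_expB (hb : LocalCoeff a α b T) (c : ℂ) :
    HasPrim (expB b c) (fun t => c * b t * expB b c t) T := by
  have h : HasPrim (fun t => (primB b t : ℂ)) (fun t => (b t : ℂ)) T := by
    have hi : IntervalIntegrable (fun t => (b t : ℂ)) volume 0 T := by
      have := hb.b_int
      rw [intervalIntegrable_iff] at this ⊢
      exact this.ofReal
    refine ⟨hi, fun t _ => ?_⟩
    simp only [primB, intervalIntegral.integral_same, Complex.ofReal_zero, zero_add]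
    exact (intervalIntegral.integral_ofReal).symm
  exact (h.const_mul c).cexp hb.nonneg

theorem LocalCoeff.continuousOn_expB (hb : LocalCoeff a α b T) (c : ℂ) :
    ContinuousOn (expB b c) (Icc 0 T) := (hb.hasPrim_expB c).continuousOn hb.nonneg

/-- The pair `(φ, w)`, with `w = exp(2 i ξ B) φ'`, solves the equation on `[0, T]` in its integral
form. -/
structure IntegralSolution (a : Measure ℝ) (b : ℝ → ℝ) (T : ℝ) (ξ : ℂ) (φ w : ℝ → ℂ) : Prop where
  cont : ContinuousOn φ (Icc 0 T)
  φ_eq : ∀ t ∈ Icc 0 T,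
    φ t = φ 0 + ∫ s in (0 : ℝ)..t, expB b (-(2 * Complex.I * ξ)) s * w s
  w_eq : ∀ t ∈ Icc 0 T,
    w t = w 0 + ξ ^ 2 * ∫ u in Ico 0 t, expB b (2 * Complex.I * ξ) u * φ u ∂a

theorem IntegralSolution.integrableOn (hb : LocalCoeff a α b T)
    (h : IntegralSolution a b T ξ φ w) :
    IntegrableOn (fun u => expB b (2 * Complex.I * ξ) u * φ u) (Icc 0 T) a :=
  integrableOn_of_continuousOn hb.finite ((hb.continuousOn_expB _).mul h.cont)

/-- Integration by parts for the product of an absolutely continuous function with `w`. -/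
theorem IntegralSolution.mul_w (hb : LocalCoeff a α b T) (h : IntegralSolution a b T ξ φ w)
    {G g : ℝ → ℂ} (hG : HasPrim G g T) :
    IntervalIntegrable (fun s => g s * w s) volume 0 T ∧
    ∀ s ∈ Icc 0 T, ∀ t ∈ Icc 0 T, s ≤ t → G t * w t - G s * w s =
      ξ ^ 2 * (∫ u in Ico s t, G u * (expB b (2 * Complex.I * ξ) u * φ u) ∂a)
        + ∫ u in s..t, g u * w u := by
  set f : ℝ → ℂ := fun u => expB b (2 * Complex.I * ξ) u * φ u with hf
  have hfi : IntegrableOn f (Icc 0 T) a := h.integrableOn hb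
  have hTT : T ∈ Icc 0 T := ⟨hb.nonneg, le_rfl⟩
  have h0 : (0 : ℝ) ∈ Icc 0 T := ⟨le_rfl, hb.nonneg⟩
  have hGf : IntegrableOn (fun u => G u * f u) (Icc 0 T) a :=
    integrableOn_of_continuousOn hb.finite
      ((hG.continuousOn hb.nonneg).mul ((hb.continuousOn_expB _).mul h.cont))
  have hv := (hG.mul_stieltjes hb.finite hfi hTT).1
  have hgw : ∀ u ∈ Icc 0 T, g u * w u = g u * w 0 + ξ ^ 2 * (g u * ∫ r in Ico 0 u, f r ∂a) := by
    intro u hu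
    rw [h.w_eq u hu]
    ring
  have hi' := (hG.int.mul_const (w 0)).add (hv.const_mul (ξ ^ 2))
  have hi : IntervalIntegrable (fun s => g s * w s) volume 0 T := by
    refine hi'.congr fun u hu => ?_
    rw [uIoc_of_le hb.nonneg] at hu
    exact (hgw u ⟨hu.1.le, hu.2⟩).symm
  refine ⟨hi, ?_⟩
  have key : ∀ t ∈ Icc 0 T, G t * w t = G 0 * w 0 + ξ ^ 2 * (∫ u in Ico 0 t, G u * f u ∂a)
      + ∫ u in (0 : ℝ)..t, g u * w u := by
    intro t ht
    have e := (hG.mul_stieltjes hb.finite hfi ht)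
    have e1 : ∫ u in (0 : ℝ)..t, g u * w u = (∫ u in (0 : ℝ)..t, g u) * w 0
        + ξ ^ 2 * ∫ u in (0 : ℝ)..t, g u * ∫ r in Ico 0 u, f r ∂a := by
      rw [← intervalIntegral.integral_mul_const, ← intervalIntegral.integral_const_mul,
        ← intervalIntegral.integral_add]
      · refine intervalIntegral.integral_congr fun u hu => ?_
        rw [uIcc_of_le ht.1] at hu
        exact hgw u ⟨hu.1, hu.2.trans ht.2⟩
      · exact (IntervalIntegrable.mono_of_mem hG.int h0 ht).mul_const _
      · exact e.1.const_mul _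
    rw [e1, h.w_eq t ht]
    have e2 := hG.eq t ht
    linear_combination (ξ ^ 2) * e.2 + (w 0) * e2
  intro s hs t ht hst
  rw [key t ht, key s hs, ← integral_Ico_sub hGf hs.1 hst ht.2,
    ← intervalIntegral.integral_interval_sub_left (IntervalIntegrable.mono_of_mem hi h0 ht)
      (IntervalIntegrable.mono_of_mem hi h0 hs)]
  ring

theorem IntegralSolution.hasPrim (hb : LocalCoeff a α b T) (h : IntegralSolution a b T ξ φ w) :
    HasPrim φ (fun t => expB b (-(2 * Complex.I * ξ)) t * w t) T := by
  refine ⟨?_, h.φ_eq⟩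
  -- With `G(t) = t` the density `g` is `1`, so the integrability part of `mul_w` says that `w`
  -- itself is integrable.
  have := (h.mul_w hb (hasPrim_id (T := T))).1
  refine (this.continuousOn_mul (g := expB b (-(2 * Complex.I * ξ))) ?_).congr fun t _ => ?_
  · rw [uIcc_of_le hb.nonneg]; exact hb.continuousOn_expB _
  · simp

/-- The Wronskian of two solutions is constant. -/
theorem IntegralSolution.wronskian (hb : LocalCoeff a α b T) {φ₁ w₁ φ₂ w₂ : ℝ → ℂ}
    (h₁ : IntegralSolution a b T ξ φ₁ w₁) (h₂ : IntegralSolution a b T ξ φ₂ w₂) {t : ℝ}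
    (ht : t ∈ Icc 0 T) : φ₁ t * w₂ t - φ₂ t * w₁ t = φ₁ 0 * w₂ 0 - φ₂ 0 * w₁ 0 := by
  have h0 : (0 : ℝ) ∈ Icc 0 T := ⟨le_rfl, hb.nonneg⟩
  -- Both products have the same `a`-integral and the same Lebesgue integral, so these cancel in the
  -- difference.
  have e1 := (h₂.mul_w hb (h₁.hasPrim hb)).2 0 h0 t ht ht.1
  have e2 := (h₁.mul_w hb (h₂.hasPrim hb)).2 0 h0 t ht ht.1
  have e3 : (fun u => φ₁ u * (expB b (2 * Complex.I * ξ) u * φ₂ u)) =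
      fun u => φ₂ u * (expB b (2 * Complex.I * ξ) u * φ₁ u) := by
    ext u; ring
  have e4 : (fun u => expB b (-(2 * Complex.I * ξ)) u * w₁ u * w₂ u) =
      fun u => expB b (-(2 * Complex.I * ξ)) u * w₂ u * w₁ u := by
    ext u; ring
  rw [e3, e4] at e1
  linear_combination e1 - e2

theorem IntegralSolution.add_const_mul (hb : LocalCoeff a α b T) {φ₁ w₁ φ₂ w₂ : ℝ → ℂ}
    (h₁ : IntegralSolution a b T ξ φ₁ w₁) (h₂ : IntegralSolution a b T ξ φ₂ w₂) (c : ℂ) :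
    IntegralSolution a b T ξ (fun t => φ₁ t + c * φ₂ t) (fun t => w₁ t + c * w₂ t) := by
  have h0 : (0 : ℝ) ∈ Icc 0 T := ⟨le_rfl, hb.nonneg⟩
  refine ⟨h₁.cont.add (h₂.cont.const_mul c |>.congr fun _ _ => rfl), fun t ht => ?_, fun t ht => ?_⟩
  · have i1 := IntervalIntegrable.mono_of_mem (h₁.hasPrim hb).int h0 ht
    have i2 := IntervalIntegrable.mono_of_mem (h₂.hasPrim hb).int h0 ht
    have e : (fun s => expB b (-(2 * Complex.I * ξ)) s * (w₁ s + c * w₂ s)) = fun s =>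
        expB b (-(2 * Complex.I * ξ)) s * w₁ s + c * (expB b (-(2 * Complex.I * ξ)) s * w₂ s) := by
      ext s; ring
    rw [e, intervalIntegral.integral_add i1 (i2.const_mul c), intervalIntegral.integral_const_mul]
    linear_combination h₁.φ_eq t ht + c * h₂.φ_eq t ht
  · have i1 := integrableOn_Ico_of_Icc (h₁.integrableOn hb) le_rfl ht.2
    have i2 := integrableOn_Ico_of_Icc (h₂.integrableOn hb) le_rfl ht.2
    have e : (fun s => expB b (2 * Complex.I * ξ) s * (φ₁ s + c * φ₂ s)) = fun s =>
        expB b (2 * Complex.I * ξ) s * φ₁ s + c * (expB b (2 * Complex.I * ξ) s * φ₂ s) := by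
      ext s; ring
    rw [e, integral_add i1 (i2.const_mul c), integral_const_mul]
    linear_combination h₁.w_eq t ht + c * h₂.w_eq t ht

/-! ### The energy identity -/

/-- Completion of the square, with `p = φ'`, `z = φ` and `β = b`: the part `b² dt` of `a` is exactly
what turns the form in `φ'` and `φ` into `|φ' + iξbφ|²`. What remains of `a` is `ã`. -/
theorem re_energy_density (ξ p z : ℂ) (hξ : 0 < ξ.re) (β : ℝ) :
    ξ.re * (β ^ 2 * ‖z‖ ^ 2)
      + ((p * (starRingEnd ℂ) p - 2 * Complex.I * ξ.re * β * p * (starRingEnd ℂ) z) / ξ).re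
      = ξ.re / ‖ξ‖ ^ 2 * ‖p + Complex.I * ξ * β * z‖ ^ 2 := by
  have hn : Complex.normSq ξ ≠ 0 := by
    rw [Complex.normSq_apply]
    nlinarith [mul_pos hξ hξ, mul_self_nonneg ξ.im]
  simp only [← Complex.normSq_eq_norm_sq]
  rw [Complex.div_re]
  have e : ∀ z : ℂ, Complex.normSq z = z.re * z.re + z.im * z.im := Complex.normSq_apply
  field_simp
  simp only [e, Complex.add_re, Complex.add_im, Complex.sub_re, Complex.sub_im, Complex.mul_re,
    Complex.mul_im, Complex.I_re, Complex.I_im, Complex.ofReal_re, Complex.ofReal_im,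
    Complex.conj_re, Complex.conj_im, Complex.re_ofNat, Complex.im_ofNat]
  ring

/-- The weight `exp(-2 (Im ξ) B(t))`. -/
noncomputable def weight (b : ℝ → ℝ) (ξ : ℂ) (t : ℝ) : ℝ := Real.exp (-2 * ξ.im * primB b t)

/-- The multiplier `exp(-2i Re ξ B)`, unlike `exp(-2iξB)`, leaves a positive weight in front of
`|φ|² da`. -/
theorem expB_weight (b : ℝ → ℝ) (ξ : ℂ) (t : ℝ) :
    expB b (-(2 * Complex.I * ξ.re)) t * expB b (2 * Complex.I * ξ) t = (weight b ξ t : ℂ) := by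
  rw [expB_mul, expB, weight, Complex.ofReal_exp]
  congr 1
  push_cast
  conv_lhs => rw [← Complex.re_add_im ξ]
  simp only [Complex.add_re, Complex.ofReal_re, Complex.mul_re, Complex.I_re, mul_zero,
    Complex.ofReal_im, Complex.I_im, mul_one, sub_self, add_zero]
  linear_combination (2 * (ξ.im : ℂ) * primB b t) * Complex.I_sq

/-- The real part of `exp(-2 (Im ξ) B) φ' φ̄ / ξ`. -/
noncomputable def flux (b : ℝ → ℝ) (ξ : ℂ) (φ w : ℝ → ℂ) (t : ℝ) : ℝ :=
  (weight b ξ t * (starRingEnd ℂ) (φ t) * (expB b (-(2 * Complex.I * ξ)) t * w t) / ξ).re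

/-- `exp(-2 (Im ξ) B) |φ' + i ξ b φ|²`, which is `|φ̃'|²` for `φ̃ = exp(i ξ B) φ`. -/
noncomputable def tildeDensity (b : ℝ → ℝ) (ξ : ℂ) (φ w : ℝ → ℂ) (t : ℝ) : ℝ :=
  weight b ξ t * ‖expB b (-(2 * Complex.I * ξ)) t * w t + Complex.I * ξ * b t * φ t‖ ^ 2

theorem tildeDensity_nonneg (b : ℝ → ℝ) (ξ : ℂ) (φ w : ℝ → ℂ) (t : ℝ) :
    0 ≤ tildeDensity b ξ φ w t := by
  unfold tildeDensity weight
  positivity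

theorem LocalCoeff.continuousOn_weight (hb : LocalCoeff a α b T) (ξ : ℂ) :
    ContinuousOn (weight b ξ) (Icc 0 T) := by
  have h := (hb.continuousOn_expB (-(2 * Complex.I * ξ.re))).mul
    (hb.continuousOn_expB (2 * Complex.I * ξ))
  have := Complex.continuous_re.comp_continuousOn h
  refine this.congr fun t ht => ?_
  simp [Function.comp, expB_weight]

/-- Integration by parts for `exp(-2i Re ξ B) φ̄ · w`, divided by `ξ`. The `a`-integral acquires the
factor `ξ² / ξ = ξ`, so its real part has the factor `Re ξ`; splitting `a` and applying
`re_energy_density` completes the square. -/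
theorem IntegralSolution.energy_identity (hb : LocalCoeff a α b T)
    (h : IntegralSolution a b T ξ φ w) (hξ : 0 < ξ.re) :
    IntervalIntegrable (tildeDensity b ξ φ w) volume 0 T ∧
    ∀ s ∈ Icc 0 T, ∀ t ∈ Icc 0 T, s ≤ t →
      flux b ξ φ w t - flux b ξ φ w s =
        ξ.re * (∫ u in Ico s t, weight b ξ u * ‖φ u‖ ^ 2 ∂α)
          + ξ.re / ‖ξ‖ ^ 2 * ∫ u in s..t, tildeDensity b ξ φ w u := by
  have hξ0 : ξ ≠ 0 := fun e => by simp [e] at hξ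
  set p : ℝ → ℂ := fun t => expB b (-(2 * Complex.I * ξ)) t * w t with hp
  have hφ : HasPrim φ p T := h.hasPrim hb
  have hw : ∀ t, w t = expB b (2 * Complex.I * ξ) t * p t := fun t =>
    (expB_mul_neg_cancel _ _ _ _).symm
  have hg := (hb.hasPrim_expB (-(2 * Complex.I * ξ.re))).mul hb.nonneg hφ.star
  obtain ⟨hi, hP⟩ := h.mul_w hb hg
  have hc : ContinuousOn (fun u => weight b ξ u * ‖φ u‖ ^ 2) (Icc 0 T) :=
    (hb.continuousOn_weight ξ).mul (h.cont.norm.pow 2)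
  have hFeq : ∀ u, (-(2 * Complex.I * ξ.re) * b u * expB b (-(2 * Complex.I * ξ.re)) u
      * (starRingEnd ℂ) (φ u) + expB b (-(2 * Complex.I * ξ.re)) u * (starRingEnd ℂ) (p u)) * w u
      = weight b ξ u * (p u * (starRingEnd ℂ) (p u)
        - 2 * Complex.I * ξ.re * b u * p u * (starRingEnd ℂ) (φ u)) := by
    intro u
    rw [hw u, ← expB_weight]
    ring
  simp only [hFeq] at hi hP
  have hb2 : IntervalIntegrable (fun u => b u ^ 2 * (weight b ξ u * ‖φ u‖ ^ 2)) volume 0 T :=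
    hb.sq_int.mul_continuousOn (by rwa [uIcc_of_le hb.nonneg])
  have hre : ∀ u, ξ.re * (b u ^ 2 * (weight b ξ u * ‖φ u‖ ^ 2)) +
      (ξ⁻¹ * (weight b ξ u * (p u * (starRingEnd ℂ) (p u)
        - 2 * Complex.I * ξ.re * b u * p u * (starRingEnd ℂ) (φ u)))).re
      = ξ.re / ‖ξ‖ ^ 2 * tildeDensity b ξ φ w u := by
    intro u
    have := re_energy_density ξ (p u) (φ u) hξ (b u)
    have e : tildeDensity b ξ φ w u
        = weight b ξ u * ‖p u + Complex.I * ξ * b u * φ u‖ ^ 2 := rfl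
    rw [e, mul_left_comm (ξ.re / ‖ξ‖ ^ 2), ← this, mul_left_comm ξ⁻¹, Complex.re_ofReal_mul,
      div_eq_inv_mul]
    ring
  have hi1 : IntervalIntegrable (fun u => (ξ⁻¹ * (weight b ξ u * (p u * (starRingEnd ℂ) (p u)
        - 2 * Complex.I * ξ.re * b u * p u * (starRingEnd ℂ) (φ u)))).re) volume 0 T := by
    have := hi.const_mul ξ⁻¹
    rw [intervalIntegrable_iff] at this ⊢
    exact this.re
  have hn : ξ.re / ‖ξ‖ ^ 2 ≠ 0 := by
    have : 0 < ‖ξ‖ := norm_pos_iff.2 hξ0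
    positivity
  have hti : IntervalIntegrable (tildeDensity b ξ φ w) volume 0 T := by
    have := (((hb2.const_mul ξ.re).add hi1).congr (g := fun u => ξ.re / ‖ξ‖ ^ 2 *
      tildeDensity b ξ φ w u) fun u _ => hre u).const_mul (ξ.re / ‖ξ‖ ^ 2)⁻¹
    refine this.congr fun u _ => ?_
    rw [← mul_assoc, inv_mul_cancel₀ hn, one_mul]
  refine ⟨hti, fun s hs t ht hst => ?_⟩
  have hsubset : uIcc s t ⊆ uIcc 0 T := by
    rw [uIcc_of_le hb.nonneg]; exact uIcc_subset_Icc hs ht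
  have hfl : ∀ t, flux b ξ φ w t =
      (ξ⁻¹ * (expB b (-(2 * Complex.I * ξ.re)) t * (starRingEnd ℂ) (φ t) * w t)).re := by
    intro t
    have e : flux b ξ φ w t = (weight b ξ t * (starRingEnd ℂ) (φ t) * p t / ξ).re := rfl
    rw [e, hw t, div_eq_inv_mul, ← expB_weight]
    congr 2
    ring
  have hsplit := (hb.split _ hc s hs t ht hst).2
  have hI1 : (∫ u in Ico s t, expB b (-(2 * Complex.I * ξ.re)) u * (starRingEnd ℂ) (φ u)
      * (expB b (2 * Complex.I * ξ) u * φ u) ∂a)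
      = ((∫ u in Ico s t, weight b ξ u * ‖φ u‖ ^ 2 ∂a : ℝ) : ℂ) := by
    rw [← integral_complex_ofReal]
    congr 1
    ext u
    push_cast
    rw [← expB_weight, ← Complex.mul_conj']
    ring
  rw [hfl, hfl, ← Complex.sub_re, ← mul_sub, hP s hs t ht hst, hI1, mul_add, Complex.add_re,
    show ξ⁻¹ * (ξ ^ 2 * ((∫ u in Ico s t, weight b ξ u * ‖φ u‖ ^ 2 ∂a : ℝ) : ℂ)) =
      ((∫ u in Ico s t, weight b ξ u * ‖φ u‖ ^ 2 ∂a : ℝ) : ℂ) * ξ by field_simp,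
    Complex.re_ofReal_mul, hsplit, ← intervalIntegral.integral_const_mul,
    ← intervalIntegral.integral_const_mul]
  have hI2 : (∫ u in s..t, ξ⁻¹ * (weight b ξ u * (p u * (starRingEnd ℂ) (p u)
        - 2 * Complex.I * ξ.re * b u * p u * (starRingEnd ℂ) (φ u)))).re =
      ∫ u in s..t, (ξ⁻¹ * (weight b ξ u * (p u * (starRingEnd ℂ) (p u)
        - 2 * Complex.I * ξ.re * b u * p u * (starRingEnd ℂ) (φ u)))).re :=
    (Complex.reCLM.intervalIntegral_comp_comm ((hi.const_mul ξ⁻¹).mono_set hsubset)).symm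
  rw [hI2]
  have : ∫ u in s..t, ξ.re / ‖ξ‖ ^ 2 * tildeDensity b ξ φ w u =
      ξ.re * (∫ u in s..t, b u ^ 2 * (weight b ξ u * ‖φ u‖ ^ 2)) +
      ∫ u in s..t, (ξ⁻¹ * (weight b ξ u * (p u * (starRingEnd ℂ) (p u)
        - 2 * Complex.I * ξ.re * b u * p u * (starRingEnd ℂ) (φ u)))).re := by
    rw [← intervalIntegral.integral_const_mul, ← intervalIntegral.integral_add
      ((hb2.const_mul _).mono_set hsubset) (hi1.mono_set hsubset)]
    exact intervalIntegral.integral_congr fun u _ => (hre u).symm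
  rw [this]
  ring

end RogersODE

namespace RogersODE

/-! ### The half-open interval `[0, R)` -/

variable {R : EReal} {a : Measure ℝ} {b : ℝ → ℝ} {T : ℝ}

theorem Icc_subset_dom (hT : T ∈ dom R) : Icc 0 T ⊆ dom R := fun _ ht =>
  ⟨ht.1, (EReal.coe_le_coe_iff.2 ht.2).trans_lt hT.2⟩

theorem ordConnected_dom (R : EReal) : (dom R).OrdConnected :=
  ⟨fun _ hx _ hy _ hz => Icc_subset_dom hy ⟨hx.1.trans hz.1, hz.2⟩⟩

theorem measurableSet_dom (R : EReal) : MeasurableSet (dom R) := (ordConnected_dom R).measurableSet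

theorem zero_mem_dom (hR : 0 < R) : (0 : ℝ) ∈ dom R := ⟨le_rfl, by simpa using hR⟩

/-- `[0, R)` is exhausted by a sequence of compact intervals. -/
theorem exists_exhaustion (hR : 0 < R) : ∃ τ : ℕ → ℝ, Monotone τ ∧ (∀ n, 0 < τ n ∧ τ n ∈ dom R) ∧
    ∀ t ∈ dom R, ∀ᶠ n in atTop, t < τ n := by
  induction R with
  | bot => simp at hR
  | top =>
    refine ⟨fun n => n + 1, fun m n h => by simpa using h,
      fun n => ⟨by positivity, by positivity, EReal.coe_lt_top _⟩, fun t _ => ?_⟩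
    filter_upwards [eventually_gt_atTop ⌈t⌉₊] with n hn
    have := Nat.lt_of_ceil_lt hn
    linarith
  | coe r =>
    have hr : 0 < r := by simpa using hR
    have hlt : ∀ n : ℕ, 0 < r / ((n : ℝ) + 2) ∧ r / ((n : ℝ) + 2) < r := fun n =>
      ⟨by positivity, div_lt_self hr (by have : (0 : ℝ) ≤ n := by positivity
                                         linarith)⟩
    -- The shift by `2` makes the first point `r/2`; a shift by `1` would give `0`, and all points
    -- must be positive.
    refine ⟨fun n => r - r / ((n : ℝ) + 2), fun m n h => ?_, fun n => ?_, fun t ht => ?_⟩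
    · have : (m : ℝ) ≤ n := by exact_mod_cast h
      simp only
      gcongr
    · have := hlt n
      exact ⟨by linarith, by linarith, EReal.coe_lt_coe_iff.2 (by linarith)⟩
    · have htr : t < r := EReal.coe_lt_coe_iff.1 ht.2
      have hl : Tendsto (fun n : ℕ => r - r / ((n : ℝ) + 2)) atTop (𝓝 (r - 0)) := by
        refine tendsto_const_nhds.sub (tendsto_const_nhds.div_atTop ?_)
        exact tendsto_atTop_add_const_right _ _ tendsto_natCast_atTop_atTop
      exact hl.eventually (lt_mem_nhds (by linarith))

theorem dom_eq_iUnion {τ : ℕ → ℝ} (h1 : ∀ n, 0 < τ n ∧ τ n ∈ dom R)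
    (h2 : ∀ t ∈ dom R, ∀ᶠ n in atTop, t < τ n) : dom R = ⋃ n, Icc 0 (τ n) := by
  refine Subset.antisymm (fun t ht => ?_) (iUnion_subset fun n => Icc_subset_dom (h1 n).2)
  obtain ⟨n, hn⟩ := (h2 t ht).exists
  exact mem_iUnion.2 ⟨n, ht.1, hn.le⟩

/-! ### Localization of the coefficients -/

theorem Coefficients.aemeasurable (h : Coefficients R a b) :
    AEMeasurable b (volume.restrict (dom R)) :=
  aemeasurable_restrict_of_measurable_subtype (measurableSet_dom R) h.b_measurable

theorem Coefficients.integral_split (h : Coefficients R a b) {s t : ℝ} (hst : Ico s t ⊆ dom R)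
    {f : ℝ → ℝ} (hf : IntegrableOn f (Ico s t) a) :
    IntegrableOn f (Ico s t) (tildeA R a b) ∧
      ∫ u in Ico s t, f u ∂a = (∫ u in Ico s t, f u ∂(tildeA R a b))
        + ∫ u in Ico s t, b u ^ 2 * f u := by
  have e : a.restrict (Ico s t) =
      (tildeA R a b).restrict (Ico s t) + (sqMeasure R b).restrict (Ico s t) := by
    rw [← Measure.restrict_add, tildeA_add_sqMeasure h, Measure.restrict_restrict measurableSet_Ico,
      inter_eq_self_of_subset_left hst]
  rw [IntegrableOn, e, integrable_add_measure] at hf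
  refine ⟨hf.1, ?_⟩
  rw [e, integral_add_measure hf.1 hf.2]
  congr 1
  have hm : AEMeasurable b (volume.restrict (Ico s t)) :=
    h.aemeasurable.mono_measure (Measure.restrict_mono hst le_rfl)
  rw [sqMeasure, restrict_withDensity measurableSet_Ico,
    Measure.restrict_restrict measurableSet_Ico, inter_eq_self_of_subset_left hst,
    integral_withDensity_eq_integral_toReal_smul₀ (by fun_prop) (by simp)]
  refine integral_congr_ae (Eventually.of_forall fun u => ?_)
  simp only [smul_eq_mul]
  rw [ENNReal.toReal_ofReal (sq_nonneg _)]

theorem Coefficients.localCoeff (h : Coefficients R a b) (hT : T ∈ dom R) :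
    LocalCoeff a (tildeA R a b) b T := by
  have hm : AEMeasurable b (volume.restrict (Icc 0 T)) :=
    h.aemeasurable.mono_measure (Measure.restrict_mono (Icc_subset_dom hT) le_rfl)
  have h2 := h.b_sq_integrable T hT
  -- Dominated by `1 + b²`.
  have h1 : IntegrableOn b (Icc 0 T) := by
    refine ((integrable_const (1 : ℝ)).add h2).mono' hm.aestronglyMeasurable
      (Eventually.of_forall fun t => ?_)
    simp only [Pi.add_apply, Real.norm_eq_abs]
    nlinarith [sq_nonneg (|b t| - 1), sq_abs (b t), abs_nonneg (b t)]
  refine ⟨hT.1, h.a_finite T hT, ?_, ?_, ?_⟩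
  · rw [intervalIntegrable_iff_integrableOn_Icc_of_le hT.1]
    exact h1
  · rw [intervalIntegrable_iff_integrableOn_Icc_of_le hT.1]
    exact h2
  · intro f hf s hs t ht hst
    have hsub : Ico s t ⊆ Icc 0 T := fun u hu => ⟨hs.1.trans hu.1, hu.2.le.trans ht.2⟩
    have := h.integral_split (hsub.trans (Icc_subset_dom hT))
      ((integrableOn_of_continuousOn (h.a_finite T hT) hf).mono_set hsub)
    rwa [intervalIntegral.integral_of_le hst, ← integral_Ico_eq_integral_Ioc]

/-! ### Equivalence of the two forms of the equation -/

/-- The function `dφ` is measurable because it agrees almost everywhere with `deriv φ`, and bounded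
because it has bounded variation; this gives the integrability needed to recover `φ`. -/
theorem IsSolution.hasPrim {ξ : ℝ} {φ dφ : ℝ → ℂ} (hs : IsSolution R a b ξ φ dφ)
    (hT : T ∈ dom R) : HasPrim φ dφ T := by
  have h0 : (0 : ℝ) ∈ dom R := Icc_subset_dom hT ⟨le_rfl, hT.1⟩
  have hd : ∀ᵐ t, t ∈ Icc 0 T → HasDerivAt φ (dφ t) t := by
    filter_upwards [(ae_restrict_iff' (measurableSet_dom R)).1 hs.hasDeriv] with t ht htT
    exact ht (Icc_subset_dom hT htT)
  refine HasPrim.of_absCont hT.1 (hs.absCont T hT) ?_ hd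
  rw [intervalIntegrable_iff_integrableOn_Icc_of_le hT.1]
  have hmeas : AEStronglyMeasurable dφ (volume.restrict (Icc 0 T)) := by
    refine (measurable_deriv φ).aestronglyMeasurable.congr ?_
    filter_upwards [(ae_restrict_iff' measurableSet_Icc).2 hd] with t ht
    exact ht.deriv
  have hbv := hs.boundedVar 0 T h0 hT
  rw [inter_eq_self_of_subset_right (Icc_subset_dom hT)] at hbv
  have : BoundedVariationOn dφ (Icc 0 T) := hbv
  refine Integrable.of_bound hmeas (‖dφ 0‖ + (eVariationOn dφ (Icc 0 T)).toReal)
    ((ae_restrict_iff' measurableSet_Icc).2 (Eventually.of_forall fun t ht => ?_))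
  have h1 := this.dist_le ht ⟨le_rfl, hT.1⟩
  rw [dist_eq_norm] at h1
  have h2 : ‖dφ t‖ ≤ ‖dφ 0‖ + ‖dφ t - dφ 0‖ := by
    simpa using norm_add_le (dφ 0) (dφ t - dφ 0)
  linarith

theorem IsSolution.integralSolution (hab : Coefficients R a b) {ξ : ℝ} {φ dφ : ℝ → ℂ}
    (hs : IsSolution R a b ξ φ dφ) (hT : T ∈ dom R) :
    IntegralSolution a b T ξ φ (fun t => expB b (2 * Complex.I * ξ) t * dφ t) := by
  have hb := hab.localCoeff hT
  have hφ := hs.hasPrim hT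
  have hφc := hφ.continuousOn hT.1
  have h0 : (0 : ℝ) ∈ Icc 0 T := ⟨le_rfl, hT.1⟩
  refine ⟨hφc, ?_, ?_⟩
  · simp only [expB_neg_mul_cancel]
    exact hφ.eq
  intro t ht
  set c : ℂ := 2 * Complex.I * ξ with hc
  have hbd : IntervalIntegrable (fun u => (b u : ℂ) * dφ u) volume 0 T := by
    have hm : IntegrableOn (fun u => (b u : ℂ)) (Icc 0 T) :=
      ((intervalIntegrable_iff_integrableOn_Icc_of_le hT.1).1 hb.b_int).ofReal
    have hbv := hs.boundedVar 0 T (Icc_subset_dom hT h0) hT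
    rw [inter_eq_self_of_subset_right (Icc_subset_dom hT)] at hbv
    have hbv' : BoundedVariationOn dφ (Icc 0 T) := hbv
    have hdm := ((intervalIntegrable_iff_integrableOn_Icc_of_le hT.1).1 hφ.int).aestronglyMeasurable
    rw [intervalIntegrable_iff_integrableOn_Icc_of_le hT.1]
    refine hm.mul_bdd (c := ‖dφ 0‖ + (eVariationOn dφ (Icc 0 T)).toReal) hdm
      ((ae_restrict_iff' measurableSet_Icc).2 (Eventually.of_forall fun t ht => ?_))
    have h1 := hbv'.dist_le ht ⟨le_rfl, hT.1⟩
    rw [dist_eq_norm] at h1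
    have h2 : ‖dφ t‖ ≤ ‖dφ 0‖ + ‖dφ t - dφ 0‖ := by
      simpa using norm_add_le (dφ 0) (dφ t - dφ 0)
    linarith
  -- The absolutely continuous part of `dφ`. The product rule for `exp(cB) v` and integration by
  -- parts for `exp(cB)` against the Stieltjes part `φ da` are added; the drift terms cancel.
  set v : ℝ → ℂ := fun t => dφ 0 + ∫ u in (0 : ℝ)..t, -c * ((b u : ℂ) * dφ u) with hv
  have hvp : HasPrim v (fun u => -c * ((b u : ℂ) * dφ u)) T :=
    ⟨hbd.const_mul _, fun t _ => by simp [hv]⟩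
  have hd : ∀ t ∈ Icc 0 T, dφ t = v t + ξ ^ 2 * ∫ u in Ico 0 t, φ u ∂a := by
    intro t ht
    have := hs.equation 0 (Icc_subset_dom hT h0) t (Icc_subset_dom hT ht) ht.1
    simp only [hv]
    rw [intervalIntegral.integral_const_mul, intervalIntegral.integral_of_le ht.1,
      ← integral_Ico_eq_integral_Ioc]
    linear_combination this
  have hφi : IntegrableOn φ (Icc 0 T) a := integrableOn_of_continuousOn hb.finite hφc
  have e1 := ((hb.hasPrim_expB c).mul hT.1 hvp).eq t ht
  obtain ⟨i2, e2⟩ := (hb.hasPrim_expB c).mul_stieltjes hb.finite hφi ht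
  have e3 : (∫ u in (0 : ℝ)..t, (c * b u * expB b c u * v u
        + expB b c u * (-c * ((b u : ℂ) * dφ u))))
      = - (ξ ^ 2 * ∫ u in (0 : ℝ)..t, c * b u * expB b c u * ∫ r in Ico 0 u, φ r ∂a) := by
    rw [← intervalIntegral.integral_const_mul, ← intervalIntegral.integral_neg]
    refine intervalIntegral.integral_congr fun u hu => ?_
    rw [uIcc_of_le ht.1] at hu
    rw [hd u ⟨hu.1, hu.2.trans ht.2⟩]
    ring
  have hv0 : v 0 = dφ 0 := by simp [hv]
  rw [e3, hv0] at e1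
  rw [hd t ht]
  linear_combination e1 + ξ ^ 2 * e2

/-- For `u < T` the indicator of `u < t` is eventually `1` as `t ↑ T`, so dominated convergence
applies. The half-open interval is what makes this left-continuous despite atoms. -/
theorem continuousWithinAt_stieltjes {μ : Measure ℝ} {h : ℝ → ℂ}
    (hh : IntegrableOn h (Icc 0 T) μ) :
    ContinuousWithinAt (fun t => ∫ u in Ico 0 t, h u ∂μ) (Icc 0 T) T := by
  have e : ∀ t ∈ Icc 0 T, ∫ u in Ico 0 t, h u ∂μ =
      ∫ u in Ico 0 T, (Iio t).indicator h u ∂μ := by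
    intro t ht
    rw [setIntegral_indicator measurableSet_Iio]
    congr 2
    ext u
    simp only [mem_inter_iff, mem_Ico, mem_Iio]
    exact ⟨fun q => ⟨⟨q.1, q.2.trans_le ht.2⟩, q.2⟩, fun q => ⟨q.1.1, q.2⟩⟩
  have hi : Integrable h (μ.restrict (Ico 0 T)) := hh.mono_set Ico_subset_Icc_self
  have key : Tendsto (fun t => ∫ u in Ico 0 T, (Iio t).indicator h u ∂μ) (𝓝[Icc 0 T] T)
      (𝓝 (∫ u in Ico 0 T, h u ∂μ)) := by
    refine tendsto_integral_filter_of_dominated_convergence (fun u => ‖h u‖)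
      (Eventually.of_forall fun t => hi.aestronglyMeasurable.indicator measurableSet_Iio)
      (Eventually.of_forall fun t => Eventually.of_forall fun u => norm_indicator_le_norm_self _ _)
      hi.norm ((ae_restrict_iff' measurableSet_Ico).2 (Eventually.of_forall fun u hu => ?_))
    refine tendsto_const_nhds.congr' ?_
    filter_upwards [mem_nhdsWithin_of_mem_nhds (lt_mem_nhds hu.2)] with t ht
    rw [indicator_of_mem (by exact ht)]
  refine Tendsto.congr' ?_ key
  filter_upwards [self_mem_nhdsWithin] with t ht
  exact (e t ht).symm

/-- The variation of `f` is dominated by that of the monotone `m`. Allowing `m` to depend on `y`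
matters, since total masses need not stay bounded up to `R`. -/
theorem locallyBoundedVariationOn_of_norm_sub_le {f : ℝ → ℂ} {s : Set ℝ}
    (h : ∀ y ∈ s, ∃ m : ℝ → ℝ, ∀ u ∈ s ∩ Iic y, ∀ v ∈ s ∩ Iic y, u ≤ v →
      ‖f v - f u‖ ≤ m v - m u) :
    LocallyBoundedVariationOn f s := by
  intro x y hx hy
  rcases lt_or_ge y x with hyx | hxy
  · simp [BoundedVariationOn, Icc_eq_empty_of_lt hyx]
  obtain ⟨m, hm⟩ := h y hy
  have hmono : MonotoneOn m (s ∩ Iic y) := fun u hu v hv huv => by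
    have := (norm_nonneg _).trans (hm u hu v hv huv)
    linarith
  have hle : eVariationOn f (s ∩ Icc x y) ≤ eVariationOn m (s ∩ Icc x y) := by
    refine iSup_mono fun p => Finset.sum_le_sum fun i _ => ?_
    have hu := p.2.2.2 i
    have hv := p.2.2.2 (i + 1)
    have h1 := hm _ ⟨hu.1, hu.2.2⟩ _ ⟨hv.1, hv.2.2⟩ (p.2.2.1 (Nat.le_succ i))
    rw [edist_dist, edist_dist, dist_eq_norm, Real.dist_eq]
    exact ENNReal.ofReal_le_ofReal (h1.trans (le_abs_self _))
  have hm2 := (hmono.eVariationOn_eq (a := x) (b := y) ⟨hx, hxy⟩ ⟨hy, self_mem_Iic⟩).le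
  have hset : s ∩ Iic y ∩ Icc x y = s ∩ Icc x y := by
    ext u
    simp only [mem_inter_iff, mem_Iic, mem_Icc]
    tauto
  rw [hset] at hm2
  exact ((hle.trans hm2).trans_lt ENNReal.ofReal_lt_top).ne

theorem isSolution_of_integralSolution (hab : Coefficients R a b) {ξ : ℝ} (hξ : ξ ≠ 0)
    {φ w : ℝ → ℂ} (hs : ∀ T ∈ dom R, IntegralSolution a b T ξ φ w) :
    IsSolution R a b ξ φ (fun t => expB b (-(2 * Complex.I * ξ)) t * w t) := by
  obtain ⟨τ, -, hτ1, hτ2⟩ := exists_exhaustion hab.R_pos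
  have hprim : ∀ T ∈ dom R, HasPrim φ (fun t => expB b (-(2 * Complex.I * ξ)) t * w t) T :=
    fun T hT => (hs T hT).hasPrim (hab.localCoeff hT)
  have heq : ∀ s ∈ dom R, ∀ t ∈ dom R, s ≤ t →
      IntegrableOn φ (Icc 0 t) a ∧
      IntegrableOn (fun u => (b u : ℂ) * (expB b (-(2 * Complex.I * ξ)) u * w u)) (Icc 0 t) ∧
      expB b (-(2 * Complex.I * ξ)) t * w t - expB b (-(2 * Complex.I * ξ)) s * w s
        = (ξ : ℂ) ^ 2 * (∫ u in Ico s t, φ u ∂a) - 2 * Complex.I * ξ *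
          (∫ u in Ico s t, (b u : ℂ) * (expB b (-(2 * Complex.I * ξ)) u * w u)) := by
    intro s hsR t htR hst
    have hb := hab.localCoeff htR
    obtain ⟨i, e⟩ := (hs t htR).mul_w hb (hb.hasPrim_expB (-(2 * Complex.I * ξ)))
    refine ⟨integrableOn_of_continuousOn hb.finite (hs t htR).cont, ?_, ?_⟩
    · rw [← intervalIntegrable_iff_integrableOn_Icc_of_le htR.1]
      -- Integrability of `b φ'` is read off from that of `-2iξ b φ'` by division, which is why `ξ ≠
      -- 0` is required.
      have := i.const_mul (-(2 * Complex.I * ξ))⁻¹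
      refine this.congr fun u _ => ?_
      have : (ξ : ℂ) ≠ 0 := by exact_mod_cast hξ
      field_simp
    · rw [e s ⟨hsR.1, hst⟩ t ⟨htR.1, le_rfl⟩ hst, sub_eq_add_neg]
      simp only [expB_neg_mul_cancel]
      congr 1
      rw [integral_Ico_eq_integral_Ioc (μ := volume), ← intervalIntegral.integral_of_le hst,
        ← intervalIntegral.integral_const_mul, ← intervalIntegral.integral_neg]
      congr 1
      ext u
      ring
  refine ⟨fun T hT => (hprim T hT).absCont hT.1, ?_, ?_, ?_, fun s hs t ht hst => (heq s hs t ht hst).2.2⟩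
  · rw [dom_eq_iUnion hτ1 hτ2, ae_restrict_iUnion_iff]
    intro n
    exact (ae_restrict_iff' measurableSet_Icc).2 ((hprim _ (hτ1 n).2).ae_hasDerivAt (hτ1 n).1.le)
  · intro t ht
    have hb := hab.localCoeff ht
    refine ((hb.continuousOn_expB _) t ⟨ht.1, le_rfl⟩).mul ?_
    have := (continuousWithinAt_const (b := w 0)).add
      ((continuousWithinAt_const (b := (ξ : ℂ) ^ 2)).mul
        (continuousWithinAt_stieltjes ((hs t ht).integrableOn hb)))
    exact this.congr (fun u hu => (hs t ht).w_eq u hu) ((hs t ht).w_eq t ⟨ht.1, le_rfl⟩)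
  · refine locallyBoundedVariationOn_of_norm_sub_le fun y hy => ?_
    obtain ⟨iφ, ib, -⟩ := heq y hy y hy le_rfl
    refine ⟨fun t => ‖(ξ : ℂ) ^ 2‖ * (∫ u in Ico 0 t, ‖φ u‖ ∂a) + ‖2 * Complex.I * ξ‖ *
      ∫ u in Ico 0 t, ‖(b u : ℂ) * (expB b (-(2 * Complex.I * ξ)) u * w u)‖,
      fun u hu v hv huv => ?_⟩
    have e1 := integral_Ico_sub (h := fun u => ‖φ u‖) iφ.norm hu.1.1 huv hv.2
    have e2 := integral_Ico_sub
      (h := fun u => ‖(b u : ℂ) * (expB b (-(2 * Complex.I * ξ)) u * w u)‖) ib.norm hu.1.1 huv hv.2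
    rw [(heq u hu.1 v hv.1 huv).2.2]
    refine (norm_sub_le _ _).trans ?_
    rw [norm_mul, norm_mul (2 * Complex.I * (ξ : ℂ))]
    have f1 := norm_integral_le_integral_norm (μ := a.restrict (Ico u v)) φ
    have f2 := norm_integral_le_integral_norm (μ := volume.restrict (Ico u v))
      (fun u => (b u : ℂ) * (expB b (-(2 * Complex.I * ξ)) u * w u))
    rw [← e1] at f1
    rw [← e2] at f2
    calc _ ≤ _ := add_le_add (mul_le_mul_of_nonneg_left f1 (norm_nonneg _))
          (mul_le_mul_of_nonneg_left f2 (norm_nonneg _))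
      _ = _ := by ring

end RogersODE

namespace RogersODE

/-! ### Holomorphic dependence of integrals on a parameter -/

/-- Cauchy's estimate turns a locally uniform bound on the integrand into one on its derivative, so
no separate domination of the derivative has to be assumed. -/
theorem differentiable_integral_of_bound {X : Type*} [MeasurableSpace X] {μ : Measure X}
    [IsFiniteMeasure μ] {F : ℂ → X → ℂ} (hm : ∀ z, AEStronglyMeasurable (F z) μ)
    (hd : ∀ᵐ x ∂μ, Differentiable ℂ fun z => F z x)
    (hb : ∀ ρ : ℝ, ∃ M : ℝ, ∀ᵐ x ∂μ, ∀ z : ℂ, ‖z‖ ≤ ρ → ‖F z x‖ ≤ M) :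
    Differentiable ℂ fun z => ∫ x, F z x ∂μ := by
  intro z₀
  -- One unit for the ball around `z₀`, one for the Cauchy circle around each of its points.
  obtain ⟨M, hM⟩ := hb (‖z₀‖ + 2)
  have hF'm : AEStronglyMeasurable (fun x => deriv (fun z => F z x) z₀) μ := by
    have hε : Tendsto (fun n : ℕ => z₀ + ((1 / ((n : ℝ) + 1) : ℝ) : ℂ)) atTop (𝓝[≠] z₀) := by
      refine tendsto_nhdsWithin_iff.2 ⟨?_, Eventually.of_forall fun n => ?_⟩
      · have h1 : Tendsto (fun n : ℕ => ((1 / ((n : ℝ) + 1) : ℝ) : ℂ)) atTop (𝓝 ((0 : ℝ) : ℂ)) :=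
          (Complex.continuous_ofReal.tendsto 0).comp tendsto_one_div_add_atTop_nhds_zero_nat
        simpa using h1.const_add z₀
      · have h1 : (1 / ((n : ℝ) + 1)) ≠ 0 := by positivity
        have h2 : ((1 / ((n : ℝ) + 1) : ℝ) : ℂ) ≠ 0 := by exact_mod_cast h1
        simpa only [mem_compl_iff, mem_singleton_iff, add_eq_left] using h2
    refine aestronglyMeasurable_of_tendsto_ae (u := atTop)
      (f := fun n : ℕ => fun x =>
        slope (fun z => F z x) z₀ (z₀ + ((1 / ((n : ℝ) + 1) : ℝ) : ℂ))) (fun n => ?_) ?_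
    · simp only [slope_def_field]
      simp only [div_eq_mul_inv]
      exact ((hm _).sub (hm _)).mul_const _
    · filter_upwards [hd] with x hx
      exact (hasDerivAt_iff_tendsto_slope.1 (hx z₀).hasDerivAt).comp hε
  refine (hasDerivAt_integral_of_dominated_loc_of_deriv_le (s := Metric.ball z₀ 1)
    (F' := fun z x => deriv (fun z => F z x) z) (bound := fun _ => M)
    (Metric.ball_mem_nhds z₀ one_pos) (Eventually.of_forall hm) ?_ hF'm ?_
    (integrable_const M) ?_).2.differentiableAt
  · refine Integrable.of_bound (hm z₀) M ?_
    filter_upwards [hM] with x hx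
    exact hx z₀ (by linarith)
  · filter_upwards [hM, hd] with x hx hdx z hz
    have := Complex.norm_deriv_le_of_forall_mem_sphere_norm_le (c := z) (R := 1) (C := M)
      one_pos hdx.diffContOnCl (fun y hy => hx y ?_)
    · simpa using this
    · have h1 : ‖y - z‖ = 1 := by simpa [dist_eq_norm] using hy
      have h2 : ‖z - z₀‖ < 1 := by simpa [dist_eq_norm] using hz
      calc ‖y‖ = ‖z₀ + (z - z₀) + (y - z)‖ := by congr 1; ring
        _ ≤ ‖z₀‖ + ‖z - z₀‖ + ‖y - z‖ := norm_add₃_le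
        _ ≤ ‖z₀‖ + 2 := by linarith
  · filter_upwards [hd] with x hx z _
    exact (hx z).hasDerivAt

/-! ### The Volterra series -/

/-- The Volterra operator of the equation. -/
noncomputable def volterra (a : Measure ℝ) (b : ℝ → ℝ) (ξ : ℂ) (f : ℝ → ℂ) (t : ℝ) : ℂ :=
  ∫ s in (0 : ℝ)..t, expB b (-(2 * Complex.I * ξ)) s *
    (ξ ^ 2 * ∫ u in Ico 0 s, expB b (2 * Complex.I * ξ) u * f u ∂a)

/-- The terms of the Volterra series of the solution with initial values `φ₀` and `w₀`. -/
noncomputable def volterraTerm (a : Measure ℝ) (b : ℝ → ℝ) (ξ φ₀ w₀ : ℂ) : ℕ → ℝ → ℂ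
  | 0 => fun t => φ₀ + ∫ s in (0 : ℝ)..t, expB b (-(2 * Complex.I * ξ)) s * w₀
  | n + 1 => volterra a b ξ (volterraTerm a b ξ φ₀ w₀ n)

/-- The solution with initial values `φ(0) = φ₀` and `φ'(0) = w₀`. -/
noncomputable def volterraSol (a : Measure ℝ) (b : ℝ → ℝ) (φ₀ w₀ ξ : ℂ) (t : ℝ) : ℂ :=
  ∑' n, volterraTerm a b ξ φ₀ w₀ n t

/-- `exp(2 i ξ B) φ'` for the solution with initial values `φ(0) = φ₀` and `φ'(0) = w₀`. -/
noncomputable def volterraSolW (a : Measure ℝ) (b : ℝ → ℝ) (φ₀ w₀ ξ : ℂ) (t : ℝ) : ℂ :=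
  w₀ + ξ ^ 2 * ∫ u in Ico 0 t, expB b (2 * Complex.I * ξ) u * volterraSol a b φ₀ w₀ ξ u ∂a

variable {a α : Measure ℝ} {b : ℝ → ℝ} {T : ℝ}

theorem LocalCoeff.norm_expB_le (hb : LocalCoeff a α b T) (ρ : ℝ) : ∃ K : ℝ, 0 ≤ K ∧
    ∀ ξ : ℂ, ‖ξ‖ ≤ ρ → ∀ t ∈ Icc 0 T, ‖expB b (2 * Complex.I * ξ) t‖ ≤ K ∧
      ‖expB b (-(2 * Complex.I * ξ)) t‖ ≤ K := by
  have hB : ContinuousOn (primB b) (Icc 0 T) := by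
    have := intervalIntegral.continuousOn_primitive_interval
      (by rw [uIcc_of_le hb.nonneg]
          exact (intervalIntegrable_iff_integrableOn_Icc_of_le hb.nonneg).1 hb.b_int)
    rwa [uIcc_of_le hb.nonneg] at this
  obtain ⟨β, hβ⟩ := isCompact_Icc.exists_bound_of_continuousOn hB
  have key : ∀ c : ℂ, ‖c‖ ≤ 2 * ρ → ∀ t ∈ Icc 0 T, ‖expB b c t‖ ≤ Real.exp (2 * ρ * β) := by
    intro c hc t ht
    rw [expB, Complex.norm_exp]
    refine Real.exp_le_exp.2 ((Complex.re_le_norm _).trans ?_)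
    rw [norm_mul, Complex.norm_real]
    exact mul_le_mul hc (hβ t ht) (norm_nonneg _) ((norm_nonneg _).trans hc)
  refine ⟨Real.exp (2 * ρ * β), (Real.exp_pos _).le, fun ξ hξ t ht => ⟨key _ ?_ t ht, key _ ?_ t ht⟩⟩
  · simpa using hξ
  · simpa using hξ

/-- Bound for the Volterra operator, uniform for `‖ξ‖ ≤ ρ`. -/
theorem LocalCoeff.norm_volterra_le (hb : LocalCoeff a α b T) (ρ : ℝ) : ∃ L : ℝ, 0 ≤ L ∧
    ∀ ξ : ℂ, ‖ξ‖ ≤ ρ → ∀ (f : ℝ → ℂ) (m : ℝ → ℝ), MonotoneOn m (Icc 0 T) →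
      (∀ t ∈ Icc 0 T, ‖f t‖ ≤ m t) → ∀ s ∈ Icc 0 T,
        ‖expB b (-(2 * Complex.I * ξ)) s *
          (ξ ^ 2 * ∫ u in Ico 0 s, expB b (2 * Complex.I * ξ) u * f u ∂a)‖ ≤ L * m s := by
  obtain ⟨K, hK0, hK⟩ := hb.norm_expB_le ρ
  refine ⟨K * (ρ ^ 2 * (K * a.real (Icc 0 T))), by positivity, ?_⟩
  intro ξ hξ f m hm hf s hs
  have hm0 : 0 ≤ m s := (norm_nonneg _).trans (hf s hs)
  have hsub : Ico 0 s ⊆ Icc 0 T := fun u hu => ⟨hu.1, hu.2.le.trans hs.2⟩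
  have h1 : ‖∫ u in Ico 0 s, expB b (2 * Complex.I * ξ) u * f u ∂a‖
      ≤ K * m s * a.real (Icc 0 T) := by
    refine (norm_setIntegral_le_of_norm_le_const (C := K * m s)
      ((measure_mono hsub).trans_lt hb.finite) fun u hu => ?_).trans ?_
    · rw [norm_mul]
      exact mul_le_mul (hK ξ hξ u (hsub hu)).1
        ((hf u (hsub hu)).trans (hm (hsub hu) hs hu.2.le)) (norm_nonneg _) hK0
    · exact mul_le_mul_of_nonneg_left (measureReal_mono hsub hb.finite.ne) (by positivity)
  rw [norm_mul, norm_mul, norm_pow]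
  calc _ ≤ K * (ρ ^ 2 * (K * m s * a.real (Icc 0 T))) := by
        gcongr
        exact (hK ξ hξ s hs).2
    _ = _ := by ring

/-- Each application of the operator integrates the increasing majorant `M (Lt)ⁿ / n!` once more.
The constants are uniform on a disc of `ξ`, as needed for analyticity of the sum. -/
theorem LocalCoeff.norm_volterraTerm_le (hb : LocalCoeff a α b T) (φ₀ w₀ : ℂ) (ρ : ℝ) :
    ∃ L M : ℝ, 0 ≤ L ∧ 0 ≤ M ∧ ∀ (n : ℕ) (ξ : ℂ), ‖ξ‖ ≤ ρ → ∀ t ∈ Icc 0 T,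
      ‖volterraTerm a b ξ φ₀ w₀ n t‖ ≤ M * ((L * t) ^ n / n.factorial) := by
  obtain ⟨K, hK0, hK⟩ := hb.norm_expB_le ρ
  obtain ⟨L, hL0, hL⟩ := hb.norm_volterra_le ρ
  have hT := hb.nonneg
  refine ⟨L, ‖φ₀‖ + K * ‖w₀‖ * T, hL0, by positivity, fun n => ?_⟩
  induction n with
  | zero =>
    intro ξ hξ t ht
    simp only [volterraTerm, pow_zero, Nat.factorial_zero, Nat.cast_one, div_one, mul_one]
    refine (norm_add_le _ _).trans ?_
    gcongr
    refine (intervalIntegral.norm_integral_le_of_norm_le_const (C := K * ‖w₀‖) ?_).trans ?_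
    · intro s hs
      rw [uIoc_of_le ht.1] at hs
      rw [norm_mul]
      gcongr
      exact (hK ξ hξ s ⟨hs.1.le, hs.2.trans ht.2⟩).2
    · rw [sub_zero, abs_of_nonneg ht.1]
      exact mul_le_mul_of_nonneg_left ht.2 (by positivity)
  | succ n ih =>
    intro ξ hξ t ht
    set M := ‖φ₀‖ + K * ‖w₀‖ * T with hM
    have hM0 : 0 ≤ M := by positivity
    have hmono : MonotoneOn (fun t => M * ((L * t) ^ n / n.factorial)) (Icc 0 T) := by
      intro x hx y hy hxy
      have := hx.1
      simp only
      gcongr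
    have hle := hL ξ hξ _ _ hmono (ih ξ hξ)
    simp only [volterraTerm, volterra]
    refine (intervalIntegral.norm_integral_le_of_norm_le (g := fun s =>
      L * (M * ((L * s) ^ n / n.factorial))) ht.1 ?_ ?_).trans (le_of_eq ?_)
    · exact Eventually.of_forall fun s hs => hle s ⟨hs.1.le, hs.2.trans ht.2⟩
    · exact (by fun_prop : Continuous fun s : ℝ => L * (M * ((L * s) ^ n / n.factorial))).intervalIntegrable _ _
    · have : (fun s : ℝ => L * (M * ((L * s) ^ n / n.factorial))) =
          fun s => (L * M * L ^ n / n.factorial) * s ^ n := by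
        ext s; rw [mul_pow]; ring
      rw [this, intervalIntegral.integral_const_mul, integral_pow, Nat.factorial_succ]
      push_cast
      field_simp
      ring

theorem LocalCoeff.hasPrim_volterra (hb : LocalCoeff a α b T) (ξ : ℂ) {f : ℝ → ℂ}
    (hf : ContinuousOn f (Icc 0 T)) :
    HasPrim (volterra a b ξ f) (fun s => expB b (-(2 * Complex.I * ξ)) s *
      (ξ ^ 2 * ∫ u in Ico 0 s, expB b (2 * Complex.I * ξ) u * f u ∂a)) T := by
  refine ⟨?_, fun t _ => by simp [volterra]⟩
  have h1 := intervalIntegrable_stieltjes hb.finite (integrableOn_of_continuousOn hb.finite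
    ((hb.continuousOn_expB (2 * Complex.I * ξ)).mul hf)) hb.nonneg
  refine (h1.const_mul (ξ ^ 2)).continuousOn_mul ?_
  rw [uIcc_of_le hb.nonneg]
  exact hb.continuousOn_expB _

theorem LocalCoeff.continuousOn_volterraTerm (hb : LocalCoeff a α b T) (ξ φ₀ w₀ : ℂ) (n : ℕ) :
    ContinuousOn (volterraTerm a b ξ φ₀ w₀ n) (Icc 0 T) := by
  induction n with
  | zero =>
    have hi : IntervalIntegrable (fun s => expB b (-(2 * Complex.I * ξ)) s * w₀) volume 0 T :=
      ((hb.continuousOn_expB _).mul continuousOn_const).intervalIntegrable_of_Icc hb.nonneg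
    refine HasPrim.continuousOn (g := fun s => expB b (-(2 * Complex.I * ξ)) s * w₀)
      ⟨hi, fun t _ => by simp [volterraTerm]⟩ hb.nonneg
  | succ n ih => exact (hb.hasPrim_volterra ξ ih).continuousOn hb.nonneg

theorem differentiable_expB (b : ℝ → ℝ) (c : ℂ) (t : ℝ) :
    Differentiable ℂ fun ξ => expB b (c * ξ) t := by
  unfold expB
  fun_prop

theorem LocalCoeff.differentiable_volterra (hb : LocalCoeff a α b T) {f : ℂ → ℝ → ℂ}
    (hc : ∀ ξ, ContinuousOn (f ξ) (Icc 0 T)) (hd : ∀ t ∈ Icc 0 T, Differentiable ℂ fun ξ => f ξ t)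
    (hf : ∀ ρ : ℝ, ∃ M : ℝ, ∀ ξ : ℂ, ‖ξ‖ ≤ ρ → ∀ t ∈ Icc 0 T, ‖f ξ t‖ ≤ M) {t : ℝ}
    (ht : t ∈ Icc 0 T) : Differentiable ℂ fun ξ => volterra a b ξ (f ξ) t := by
  have hneg : ∀ t, Differentiable ℂ fun ξ => expB b (-(2 * Complex.I * ξ)) t := fun t => by
    simpa only [neg_mul] using differentiable_expB b (-(2 * Complex.I)) t
  have inner : ∀ s ∈ Icc 0 T, Differentiable ℂ fun ξ =>
      ∫ u in Ico 0 s, expB b (2 * Complex.I * ξ) u * f ξ u ∂a := by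
    intro s hs
    have hsub : Ico 0 s ⊆ Icc 0 T := fun u hu => ⟨hu.1, hu.2.le.trans hs.2⟩
    have : IsFiniteMeasure (a.restrict (Ico 0 s)) :=
      ⟨by simpa using (measure_mono hsub).trans_lt hb.finite⟩
    refine differentiable_integral_of_bound (fun ξ => ?_) ?_ fun ρ => ?_
    · exact (((hb.continuousOn_expB _).mul (hc ξ)).mono hsub).aestronglyMeasurable measurableSet_Ico
    · refine (ae_restrict_iff' measurableSet_Ico).2 (Eventually.of_forall fun u hu => ?_)
      exact (differentiable_expB b _ u).mul (hd u (hsub hu))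
    · obtain ⟨K, hK0, hK⟩ := hb.norm_expB_le ρ
      obtain ⟨M, hM⟩ := hf ρ
      refine ⟨K * M, (ae_restrict_iff' measurableSet_Ico).2 (Eventually.of_forall fun u hu ξ hξ => ?_)⟩
      rw [norm_mul]
      exact mul_le_mul (hK ξ hξ u (hsub hu)).1 (hM ξ hξ u (hsub hu)) (norm_nonneg _) hK0
  simp only [volterra, intervalIntegral.integral_of_le ht.1]
  have hsub : Ioc 0 t ⊆ Icc 0 T := fun u hu => ⟨hu.1.le, hu.2.trans ht.2⟩
  refine differentiable_integral_of_bound (fun ξ => ?_) ?_ fun ρ => ?_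
  · exact (((intervalIntegrable_iff_integrableOn_Icc_of_le hb.nonneg).1
      (hb.hasPrim_volterra ξ (hc ξ)).int).mono_set hsub).aestronglyMeasurable
  · refine (ae_restrict_iff' measurableSet_Ioc).2 (Eventually.of_forall fun u hu => ?_)
    exact (hneg u).mul ((differentiable_id.pow 2).mul (inner u (hsub hu)))
  · obtain ⟨L, hL0, hL⟩ := hb.norm_volterra_le ρ
    obtain ⟨M, hM⟩ := hf ρ
    refine ⟨L * M, (ae_restrict_iff' measurableSet_Ioc).2 (Eventually.of_forall fun u hu ξ hξ => ?_)⟩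
    exact hL ξ hξ (f ξ) (fun _ => M) monotoneOn_const (hM ξ hξ) u (hsub hu)

theorem LocalCoeff.differentiable_volterraTerm (hb : LocalCoeff a α b T) (φ₀ w₀ : ℂ) (n : ℕ) :
    ∀ t ∈ Icc 0 T, Differentiable ℂ fun ξ => volterraTerm a b ξ φ₀ w₀ n t := by
  induction n with
  | zero =>
    intro t ht
    have hsub : Ioc 0 t ⊆ Icc 0 T := fun u hu => ⟨hu.1.le, hu.2.trans ht.2⟩
    simp only [volterraTerm, intervalIntegral.integral_of_le ht.1]
    refine (differentiable_const _).add (differentiable_integral_of_bound (fun ξ => ?_) ?_ fun ρ => ?_)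
    · exact (((hb.continuousOn_expB _).mul continuousOn_const).mono hsub).aestronglyMeasurable
        measurableSet_Ioc
    · refine Eventually.of_forall fun u => ?_
      have : Differentiable ℂ fun ξ => expB b (-(2 * Complex.I * ξ)) u := by
        simpa only [neg_mul] using differentiable_expB b (-(2 * Complex.I)) u
      exact this.mul_const _
    · obtain ⟨K, hK0, hK⟩ := hb.norm_expB_le ρ
      refine ⟨K * ‖w₀‖, (ae_restrict_iff' measurableSet_Ioc).2
        (Eventually.of_forall fun u hu ξ hξ => ?_)⟩
      rw [norm_mul]
      exact mul_le_mul_of_nonneg_right (hK ξ hξ u (hsub hu)).2 (norm_nonneg _)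
  | succ n ih =>
    intro t ht
    refine hb.differentiable_volterra (fun ξ => hb.continuousOn_volterraTerm ξ φ₀ w₀ n) ih
      (fun ρ => ?_) ht
    obtain ⟨L, M, hL, hM, h⟩ := hb.norm_volterraTerm_le φ₀ w₀ ρ
    refine ⟨M * ((L * T) ^ n / n.factorial), fun ξ hξ t ht => (h n ξ hξ t ht).trans ?_⟩
    have := ht.1
    have := ht.2
    gcongr

/-- Uniform summable bound for the terms of the Volterra series. -/
theorem LocalCoeff.summable_bound (hb : LocalCoeff a α b T) (φ₀ w₀ : ℂ) (ρ : ℝ) :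
    ∃ u : ℕ → ℝ, Summable u ∧ ∀ (n : ℕ) (ξ : ℂ), ‖ξ‖ ≤ ρ → ∀ t ∈ Icc 0 T,
      ‖volterraTerm a b ξ φ₀ w₀ n t‖ ≤ u n := by
  obtain ⟨L, M, hL, hM, h⟩ := hb.norm_volterraTerm_le φ₀ w₀ ρ
  refine ⟨fun n => M * ((L * T) ^ n / n.factorial),
    (Real.summable_pow_div_factorial (L * T)).mul_left M, fun n ξ hξ t ht => (h n ξ hξ t ht).trans ?_⟩
  have h1 := ht.1
  have h2 := ht.2
  show M * ((L * t) ^ n / n.factorial) ≤ M * ((L * T) ^ n / n.factorial)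
  gcongr

theorem LocalCoeff.differentiable_volterraSol (hb : LocalCoeff a α b T) (φ₀ w₀ : ℂ) {t : ℝ}
    (ht : t ∈ Icc 0 T) : Differentiable ℂ fun ξ => volterraSol a b φ₀ w₀ ξ t := by
  intro ξ
  obtain ⟨u, hu, hle⟩ := hb.summable_bound φ₀ w₀ (‖ξ‖ + 1)
  refine (Complex.differentiableOn_tsum_of_summable_norm (U := Metric.ball 0 (‖ξ‖ + 1)) hu
    (fun n => (hb.differentiable_volterraTerm φ₀ w₀ n t ht).differentiableOn) Metric.isOpen_ball
    fun n z hz => hle n z (by simpa using (mem_ball_zero_iff.1 hz).le) t ht).differentiableAt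
    (Metric.isOpen_ball.mem_nhds (by simp))

theorem volterraTerm_zero_right (a : Measure ℝ) (b : ℝ → ℝ) (ξ φ₀ w₀ : ℂ) (n : ℕ) :
    volterraTerm a b ξ φ₀ w₀ n 0 = if n = 0 then φ₀ else 0 := by
  cases n <;> simp [volterraTerm, volterra]

theorem volterraSol_zero (a : Measure ℝ) (b : ℝ → ℝ) (φ₀ w₀ ξ : ℂ) :
    volterraSol a b φ₀ w₀ ξ 0 = φ₀ := by
  simp [volterraSol, volterraTerm_zero_right]

theorem volterraSolW_zero (a : Measure ℝ) (b : ℝ → ℝ) (φ₀ w₀ ξ : ℂ) :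
    volterraSolW a b φ₀ w₀ ξ 0 = w₀ := by
  simp [volterraSolW]

/-- The summable bound lets the series pass through both integrals of the Volterra operator;
shifting the index by one then gives the fixed-point equation. -/
theorem LocalCoeff.integralSolution_volterraSol (hb : LocalCoeff a α b T) (φ₀ w₀ ξ : ℂ) :
    IntegralSolution a b T ξ (volterraSol a b φ₀ w₀ ξ) (volterraSolW a b φ₀ w₀ ξ) := by
  obtain ⟨u, hu, hle⟩ := hb.summable_bound φ₀ w₀ ‖ξ‖
  obtain ⟨K, hK0, hK⟩ := hb.norm_expB_le ‖ξ‖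
  obtain ⟨L, hL0, hL⟩ := hb.norm_volterra_le ‖ξ‖
  have hcont : ContinuousOn (volterraSol a b φ₀ w₀ ξ) (Icc 0 T) :=
    continuousOn_tsum (hb.continuousOn_volterraTerm ξ φ₀ w₀) hu fun n t ht => hle n ξ le_rfl t ht
  have hsum : ∀ t ∈ Icc 0 T, HasSum (fun n => volterraTerm a b ξ φ₀ w₀ n t)
      (volterraSol a b φ₀ w₀ ξ t) := fun t ht =>
    (Summable.of_norm_bounded hu fun n => hle n ξ le_rfl t ht).hasSum
  refine ⟨hcont, fun t ht => ?_, fun t _ => by rw [volterraSolW_zero]; rfl⟩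
  have inner : ∀ s ∈ Icc 0 T, HasSum
      (fun n => ∫ r in Ico 0 s, expB b (2 * Complex.I * ξ) r * volterraTerm a b ξ φ₀ w₀ n r ∂a)
      (∫ r in Ico 0 s, expB b (2 * Complex.I * ξ) r * volterraSol a b φ₀ w₀ ξ r ∂a) := by
    intro s hs
    have hsub : Ico 0 s ⊆ Icc 0 T := fun u hu => ⟨hu.1, hu.2.le.trans hs.2⟩
    have : IsFiniteMeasure (a.restrict (Ico 0 s)) :=
      ⟨by simpa using (measure_mono hsub).trans_lt hb.finite⟩
    refine hasSum_integral_of_dominated_convergence (fun n _ => K * u n) (fun n => ?_) (fun n => ?_)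
      (Eventually.of_forall fun _ => hu.mul_left K) (integrable_const _) ?_
    · exact (((hb.continuousOn_expB _).mul (hb.continuousOn_volterraTerm ξ φ₀ w₀ n)).mono
        hsub).aestronglyMeasurable measurableSet_Ico
    · refine (ae_restrict_iff' measurableSet_Ico).2 (Eventually.of_forall fun r hr => ?_)
      rw [norm_mul]
      exact mul_le_mul (hK ξ le_rfl r (hsub hr)).1 (hle n ξ le_rfl r (hsub hr)) (norm_nonneg _) hK0
    · refine (ae_restrict_iff' measurableSet_Ico).2 (Eventually.of_forall fun r hr => ?_)
      exact (hsum r (hsub hr)).mul_left _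
  have outer : HasSum (fun n => volterraTerm a b ξ φ₀ w₀ (n + 1) t)
      (volterra a b ξ (volterraSol a b φ₀ w₀ ξ) t) := by
    have hsub : uIoc 0 t ⊆ Icc 0 T := by
      rw [uIoc_of_le ht.1]
      exact fun u hu => ⟨hu.1.le, hu.2.trans ht.2⟩
    simp only [volterraTerm, volterra]
    refine intervalIntegral.hasSum_integral_of_dominated_convergence (fun n _ => L * u n)
      (fun n => ?_) (fun n => Eventually.of_forall fun s hs => ?_)
      (Eventually.of_forall fun _ _ => hu.mul_left L) intervalIntegrable_const
      (Eventually.of_forall fun s hs => ?_)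
    · exact (((intervalIntegrable_iff_integrableOn_Icc_of_le hb.nonneg).1
        (hb.hasPrim_volterra ξ (hb.continuousOn_volterraTerm ξ φ₀ w₀ n)).int).mono_set
        hsub).aestronglyMeasurable
    · exact hL ξ le_rfl _ (fun _ => u n) monotoneOn_const (hle n ξ le_rfl) s (hsub hs)
    · exact ((inner s (hsub hs)).mul_left _).mul_left _
  have h0 : (0 : ℝ) ∈ Icc 0 T := ⟨le_rfl, hb.nonneg⟩
  have e1 : volterraSol a b φ₀ w₀ ξ t = volterraTerm a b ξ φ₀ w₀ 0 t +
      volterra a b ξ (volterraSol a b φ₀ w₀ ξ) t := by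
    rw [← outer.tsum_eq]
    exact (hsum t ht).summable.tsum_eq_zero_add
  have i1 : IntervalIntegrable (fun s => expB b (-(2 * Complex.I * ξ)) s * w₀) volume 0 t :=
    IntervalIntegrable.mono_of_mem (((hb.continuousOn_expB _).mul
      continuousOn_const).intervalIntegrable_of_Icc hb.nonneg) h0 ht
  have i2 := IntervalIntegrable.mono_of_mem (hb.hasPrim_volterra ξ hcont).int h0 ht
  rw [e1, volterraSol_zero]
  simp only [volterraTerm, volterraSolW, mul_add]
  rw [intervalIntegral.integral_add i1 i2, volterra, add_assoc]

end RogersODE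

namespace RogersODE

/-! ### Limits of bounded holomorphic functions along an ultrafilter -/

/-- A form of Montel's theorem: compactness of the disc gives pointwise limits along the
ultrafilter, and Cauchy's estimate makes the family locally equi-Lipschitz, so the convergence is
locally uniform. -/
theorem exists_ultrafilter_limit_of_norm_le_one {ι : Type*} (𝒰 : Ultrafilter ι) {F : ι → ℂ → ℂ}
    {U : Set ℂ} (hU : IsOpen U) (hd : ∀ n, DifferentiableOn ℂ (F n) U)
    (hF : ∀ n, ∀ z ∈ U, ‖F n z‖ ≤ 1) :
    ∃ g : ℂ → ℂ, DifferentiableOn ℂ g U ∧ ∀ z ∈ U, Tendsto (fun n => F n z) 𝒰 (𝓝 (g z)) := by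
  have hlim : ∀ z ∈ U, ∃ y, Tendsto (fun n => F n z) 𝒰 (𝓝 y) := by
    intro z hz
    obtain ⟨y, -, hy⟩ := (isCompact_closedBall (0 : ℂ) 1).ultrafilter_le_nhds
      (𝒰.map fun n => F n z) (by
        rw [le_principal_iff]
        exact Ultrafilter.mem_map.2 (univ_mem' fun n => by simpa using hF n z hz))
    exact ⟨y, hy⟩
  choose! g hg using hlim
  refine ⟨g, ?_, hg⟩
  suffices h : TendstoLocallyUniformlyOn F g 𝒰 U from
    h.differentiableOn (Eventually.of_forall hd) hU
  rw [Metric.tendstoLocallyUniformlyOn_iff]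
  intro ε hε z₀ hz₀
  obtain ⟨r', hr', hball⟩ := Metric.isOpen_iff.1 hU z₀ hz₀
  set r := r' / 3 with hr
  have hr0 : 0 < r := by positivity
  have hsub : ∀ z ∈ Metric.ball z₀ r, Metric.closedBall z r ⊆ U := by
    intro z hz y hy
    refine hball ?_
    rw [Metric.mem_ball] at hz ⊢
    rw [Metric.mem_closedBall] at hy
    have := dist_triangle y z z₀
    linarith
  have hder : ∀ n, ∀ z ∈ Metric.ball z₀ r, ‖deriv (F n) z‖ ≤ 1 / r := by
    intro n z hz
    refine Complex.norm_deriv_le_of_forall_mem_sphere_norm_le hr0 ?_ fun y hy =>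
      hF n y (hsub z hz (Metric.sphere_subset_closedBall hy))
    refine DifferentiableOn.diffContOnCl ((hd n).mono ?_)
    exact (Metric.closure_ball_subset_closedBall).trans (hsub z hz)
  have hlip : ∀ n, ∀ z ∈ Metric.ball z₀ r, ‖F n z - F n z₀‖ ≤ 1 / r * ‖z - z₀‖ := by
    intro n z hz
    refine (convex_ball z₀ r).norm_image_sub_le_of_norm_deriv_le (fun y hy => ?_) (hder n)
      (Metric.mem_ball_self hr0) hz
    exact (hd n).differentiableAt (hU.mem_nhds (hsub y hy (Metric.mem_closedBall_self hr0.le)))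
  set δ := min r (r * (ε / 4)) with hδ
  have hδ0 : 0 < δ := by positivity
  have hsmall : ∀ n, ∀ z ∈ Metric.ball z₀ δ, ‖F n z - F n z₀‖ ≤ ε / 4 := by
    intro n z hz
    rw [Metric.mem_ball, dist_eq_norm] at hz
    refine (hlip n z (by
      rw [Metric.mem_ball, dist_eq_norm]; exact hz.trans_le (min_le_left _ _))).trans ?_
    calc 1 / r * ‖z - z₀‖ ≤ 1 / r * (r * (ε / 4)) := by
          gcongr
          exact hz.le.trans (min_le_right _ _)
      _ = ε / 4 := by field_simp
  have hmem : ∀ z ∈ Metric.ball z₀ δ, z ∈ U := fun z hz =>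
    hsub z (Metric.ball_subset_ball (min_le_left _ _) hz) (Metric.mem_closedBall_self hr0.le)
  have hsmall' : ∀ z ∈ Metric.ball z₀ δ, ‖g z - g z₀‖ ≤ ε / 4 := fun z hz =>
    le_of_tendsto ((hg z (hmem z hz)).sub (hg z₀ hz₀)).norm
      (Eventually.of_forall fun n => hsmall n z hz)
  refine ⟨Metric.ball z₀ δ, mem_nhdsWithin_of_mem_nhds (Metric.ball_mem_nhds _ hδ0), ?_⟩
  filter_upwards [(hg z₀ hz₀).eventually (Metric.ball_mem_nhds _ (by positivity : 0 < ε / 4))]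
    with n hn z hz
  have h1 := hsmall n z hz
  have h2 := hsmall' z hz
  have h3 : ‖F n z₀ - g z₀‖ < ε / 4 := by simpa [dist_eq_norm] using hn
  rw [dist_eq_norm]
  calc ‖g z - F n z‖ = ‖(g z - g z₀) - (F n z₀ - g z₀) - (F n z - F n z₀)‖ := by
        congr 1; ring
    _ ≤ ‖g z - g z₀‖ + ‖F n z₀ - g z₀‖ + ‖F n z - F n z₀‖ :=
        (norm_sub_le _ _).trans (by gcongr; exact norm_sub_le _ _)
    _ < ε := by linarith

theorem norm_cayley_le_one {z : ℂ} (hz : 0 ≤ z.re) : ‖(z - 1) / (z + 1)‖ ≤ 1 := by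
  rw [norm_div]
  refine div_le_one_of_le₀ ?_ (norm_nonneg _)
  rw [← abs_of_nonneg (norm_nonneg (z - 1)), ← abs_of_nonneg (norm_nonneg (z + 1)), ← sq_le_sq,
    ← Complex.normSq_eq_norm_sq, ← Complex.normSq_eq_norm_sq, Complex.normSq_apply,
    Complex.normSq_apply]
  simp only [Complex.sub_re, Complex.one_re, Complex.sub_im, Complex.one_im, Complex.add_re,
    Complex.add_im]
  nlinarith

theorem add_one_ne_zero_of_re_nonneg {z : ℂ} (hz : 0 ≤ z.re) : z + 1 ≠ 0 := fun h => by
  have := congrArg Complex.re h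
  simp at this
  linarith

/-- Holomorphic functions with non-negative real part on the right half-plane which are bounded at
one point converge along every ultrafilter, and the limit is again such a function. -/
theorem exists_ultrafilter_limit_of_re_nonneg {ι : Type*} (𝒰 : Ultrafilter ι) {h : ι → ℂ → ℂ}
    (hd : ∀ n, DifferentiableOn ℂ (h n) {z : ℂ | 0 < z.re})
    (hre : ∀ n, ∀ z : ℂ, 0 < z.re → 0 ≤ (h n z).re) {z₀ : ℂ} (hz₀ : 0 < z₀.re) {C : ℝ}
    (hC : ∀ n, ‖h n z₀‖ ≤ C) :
    ∃ k : ℂ → ℂ, DifferentiableOn ℂ k {z : ℂ | 0 < z.re} ∧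
      (∀ z : ℂ, 0 < z.re → 0 ≤ (k z).re) ∧
      ∀ z : ℂ, 0 < z.re → Tendsto (fun n => h n z) 𝒰 (𝓝 (k z)) := by
  have hU : IsOpen {z : ℂ | 0 < z.re} := isOpen_lt continuous_const Complex.continuous_re
  obtain ⟨g, hgd, hg⟩ := exists_ultrafilter_limit_of_norm_le_one 𝒰
    (F := fun n z => (h n z - 1) / (h n z + 1)) hU
    (fun n => ((hd n).sub_const 1).div ((hd n).add_const 1)
      fun z hz => add_one_ne_zero_of_re_nonneg (hre n z hz))
    (fun n z hz => norm_cayley_le_one (hre n z hz))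
  have hg1 : ∀ z : ℂ, 0 < z.re → ‖g z‖ ≤ 1 := fun z hz =>
    le_of_tendsto (hg z hz).norm (Eventually.of_forall fun n => norm_cayley_le_one (hre n z hz))
  have hinv : ∀ n, ∀ z : ℂ, 0 < z.re →
      1 - (h n z - 1) / (h n z + 1) = 2 / (h n z + 1) := by
    intro n z hz
    have := add_one_ne_zero_of_re_nonneg (hre n z hz)
    field_simp
    ring
  -- The value `1` is the Cayley image of infinity; the bound at `z₀` excludes it there.
  have hgz₀ : g z₀ ≠ 1 := by
    intro h1
    have hC0 : 0 ≤ C := by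
      obtain ⟨n⟩ := (𝒰 : Filter ι).nonempty_of_neBot
      exact (norm_nonneg _).trans (hC n)
    have hl : Tendsto (fun n => ‖1 - (h n z₀ - 1) / (h n z₀ + 1)‖) 𝒰 (𝓝 0) := by
      have := ((hg z₀ hz₀).const_sub 1).norm
      rwa [h1, sub_self, norm_zero] at this
    have : 2 / (C + 1) ≤ 0 := by
      refine ge_of_tendsto hl (Eventually.of_forall fun n => ?_)
      rw [hinv n z₀ hz₀, norm_div, Complex.norm_ofNat]
      have h2 : ‖h n z₀ + 1‖ ≤ C + 1 := (norm_add_le _ _).trans (by simpa using hC n)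
      have h3 : 0 < ‖h n z₀ + 1‖ :=
        norm_pos_iff.2 (add_one_ne_zero_of_re_nonneg (hre n z₀ hz₀))
      gcongr
    have : 0 < 2 / (C + 1) := by positivity
    linarith
  -- By the maximum principle, reaching `1` anywhere would force `g` to be constantly `1`,
  -- contradicting its value at `z₀`.
  have hgne : ∀ z : ℂ, 0 < z.re → g z ≠ 1 := by
    intro z hz h1
    have hmax : IsMaxOn (norm ∘ g) {z : ℂ | 0 < z.re} z := fun y hy => by
      simp only [mem_ofPred_eq, Function.comp, h1, norm_one]
      exact hg1 y hy
    have hpre : IsPreconnected {z : ℂ | 0 < z.re} :=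
      (convex_halfSpace_re_gt 0).isPreconnected
    have := Complex.eqOn_of_isPreconnected_of_isMaxOn_norm hpre hU hgd hz hmax hz₀
    exact hgz₀ (by simpa [h1] using this)
  have hlim : ∀ z : ℂ, 0 < z.re → Tendsto (fun n => h n z) 𝒰 (𝓝 ((1 + g z) / (1 - g z))) := by
    intro z hz
    have := ((hg z hz).const_add 1).div ((hg z hz).const_sub 1) (sub_ne_zero.2 (hgne z hz).symm)
    refine this.congr fun n => ?_
    have := add_one_ne_zero_of_re_nonneg (hre n z hz)
    simp only [Pi.div_apply]
    rw [hinv n z hz]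
    field_simp
    ring
  refine ⟨fun z => (1 + g z) / (1 - g z), ?_, fun z hz => ?_, hlim⟩
  · exact (hgd.const_add 1).div (hgd.const_sub 1) fun z hz => sub_ne_zero.2 (hgne z hz).symm
  · exact ge_of_tendsto ((Complex.continuous_re.tendsto _).comp (hlim z hz))
      (Eventually.of_forall fun n => hre n z hz)

/-! ### Solutions vanishing at the right endpoint -/

variable {a α : Measure ℝ} {b : ℝ → ℝ} {T : ℝ} {ξ : ℂ} {φ w : ℝ → ℂ}

theorem weight_nonneg (b : ℝ → ℝ) (ξ : ℂ) (t : ℝ) : 0 ≤ weight b ξ t := (Real.exp_pos _).le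

theorem IntegralSolution.monotoneOn_flux (hb : LocalCoeff a α b T)
    (h : IntegralSolution a b T ξ φ w) (hξ : 0 < ξ.re) :
    MonotoneOn (flux b ξ φ w) (Icc 0 T) := by
  intro s hs t ht hst
  have e := (h.energy_identity hb hξ).2 s hs t ht hst
  have h1 : 0 ≤ ∫ u in Ico s t, weight b ξ u * ‖φ u‖ ^ 2 ∂α :=
    integral_nonneg fun u => mul_nonneg (weight_nonneg b ξ u) (by positivity)
  have h2 : 0 ≤ ∫ u in s..t, tildeDensity b ξ φ w u :=
    intervalIntegral.integral_nonneg hst fun u _ => tildeDensity_nonneg b ξ φ w u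
  have h3 : 0 ≤ ξ.re * (∫ u in Ico s t, weight b ξ u * ‖φ u‖ ^ 2 ∂α)
      + ξ.re / ‖ξ‖ ^ 2 * ∫ u in s..t, tildeDensity b ξ φ w u := by positivity
  linarith

theorem flux_eq_zero {t : ℝ} (h : φ t = 0) : flux b ξ φ w t = 0 := by
  simp [flux, h]

/-- A solution that vanishes at both endpoints has zero derivative at `0`. -/
theorem IntegralSolution.w_zero_eq_zero (hb : LocalCoeff a α b T)
    (h : IntegralSolution a b T ξ φ w) (hξ : 0 < ξ.re) (hT : 0 < T) (h0 : φ 0 = 0)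
    (h1 : φ T = 0) : w 0 = 0 := by
  have hξ0 : ξ ≠ 0 := fun e => by simp [e] at hξ
  have m0 : (0 : ℝ) ∈ Icc 0 T := ⟨le_rfl, hb.nonneg⟩
  have mT : T ∈ Icc 0 T := ⟨hb.nonneg, le_rfl⟩
  obtain ⟨hi, he⟩ := h.energy_identity hb hξ
  have e := he 0 m0 T mT hb.nonneg
  rw [flux_eq_zero h0, flux_eq_zero h1] at e
  have p1 : 0 ≤ ∫ u in Ico 0 T, weight b ξ u * ‖φ u‖ ^ 2 ∂α :=
    integral_nonneg fun u => mul_nonneg (weight_nonneg b ξ u) (by positivity)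
  have p2 : 0 ≤ ∫ u in (0 : ℝ)..T, tildeDensity b ξ φ w u :=
    intervalIntegral.integral_nonneg hb.nonneg fun u _ => tildeDensity_nonneg b ξ φ w u
  have hn : 0 < ξ.re / ‖ξ‖ ^ 2 := by
    have : 0 < ‖ξ‖ := norm_pos_iff.2 hξ0
    positivity
  have p3 : ∫ u in (0 : ℝ)..T, tildeDensity b ξ φ w u = 0 := by
    have q1 := mul_nonneg hξ.le p1
    have q2 := mul_nonneg hn.le p2
    have q3 : ξ.re / ‖ξ‖ ^ 2 * ∫ u in (0 : ℝ)..T, tildeDensity b ξ φ w u = 0 := by linarith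
    exact (mul_eq_zero.1 q3).resolve_left hn.ne'
  rw [intervalIntegral.integral_eq_zero_iff_of_le_of_nonneg_ae hb.nonneg
    (Eventually.of_forall fun u => tildeDensity_nonneg b ξ φ w u) hi] at p3
  have hz : ∀ᵐ u ∂volume.restrict (Ioc 0 T),
      expB b (-(2 * Complex.I * ξ)) u * w u + Complex.I * ξ * b u * φ u = 0 := by
    filter_upwards [p3] with u hu
    have hw : weight b ξ u ≠ 0 := (Real.exp_pos _).ne'
    simpa [tildeDensity, hw] using hu
  -- The vanishing density says that `exp(iξB) φ` has zero derivative almost everywhere; it starts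
  -- at `0`, so `φ` vanishes identically.
  have hprim := (hb.hasPrim_expB (Complex.I * ξ)).mul hb.nonneg (h.hasPrim hb)
  have hφ0 : ∀ t ∈ Icc 0 T, φ t = 0 := by
    intro t ht
    have e1 := hprim.eq t ht
    have e2 : ∫ s in (0 : ℝ)..t, (Complex.I * ξ * b s * expB b (Complex.I * ξ) s * φ s
        + expB b (Complex.I * ξ) s * (expB b (-(2 * Complex.I * ξ)) s * w s)) = 0 := by
      refine intervalIntegral.integral_zero_ae ?_
      filter_upwards [(ae_restrict_iff' measurableSet_Ioc).1 hz] with s hs hst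
      rw [uIoc_of_le ht.1] at hst
      have := hs ⟨hst.1, hst.2.trans ht.2⟩
      linear_combination expB b (Complex.I * ξ) s * this
    rw [e2, h0, mul_zero, add_zero] at e1
    exact (mul_eq_zero.1 e1).resolve_left (expB_ne_zero _ _ _)
  have : NeBot (ae (volume.restrict (Ioc 0 T))) := by
    rw [ae_neBot, Ne, Measure.restrict_eq_zero, Real.volume_Ioc]
    simpa using hT
  obtain ⟨u, hu, hmem⟩ := (hz.and (ae_restrict_mem measurableSet_Ioc)).exists
  have hmem' : u ∈ Icc 0 T := ⟨hmem.1.le, hmem.2⟩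
  rw [hφ0 u hmem', mul_zero, add_zero] at hu
  have hwu := (mul_eq_zero.1 hu).resolve_left (expB_ne_zero _ _ _)
  have hw := h.w_eq u hmem'
  rw [setIntegral_eq_zero_of_forall_eq_zero (fun r hr => by
    rw [hφ0 r ⟨hr.1, hr.2.le.trans hmem.2⟩, mul_zero]), mul_zero, add_zero] at hw
  rw [← hw, hwu]

theorem LocalCoeff.volterraSol_ne_zero (hb : LocalCoeff a α b T) (hξ : 0 < ξ.re) (hT : 0 < T) :
    volterraSol a b 0 1 ξ T ≠ 0 := fun h => by
  have := (hb.integralSolution_volterraSol 0 1 ξ).w_zero_eq_zero hb hξ hT (volterraSol_zero ..) h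
  rw [volterraSolW_zero] at this
  exact one_ne_zero this

/-- The number `k` for which the solution with `φ(0) = 1` and `φ'(0) = -k` vanishes at `T`. -/
noncomputable def truncK (a : Measure ℝ) (b : ℝ → ℝ) (T : ℝ) (ξ : ℂ) : ℂ :=
  volterraSol a b 1 0 ξ T / volterraSol a b 0 1 ξ T

/-- The solution with `φ(0) = 1` and `φ'(0) = -k`. -/
noncomputable def solK (a : Measure ℝ) (b : ℝ → ℝ) (k ξ : ℂ) (t : ℝ) : ℂ :=
  volterraSol a b 1 0 ξ t + -k * volterraSol a b 0 1 ξ t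

/-- The function `w` of the solution with `φ(0) = 1` and `φ'(0) = -k`. -/
noncomputable def solKW (a : Measure ℝ) (b : ℝ → ℝ) (k ξ : ℂ) (t : ℝ) : ℂ :=
  volterraSolW a b 1 0 ξ t + -k * volterraSolW a b 0 1 ξ t

theorem LocalCoeff.integralSolution_solK (hb : LocalCoeff a α b T) (k ξ : ℂ) :
    IntegralSolution a b T ξ (solK a b k ξ) (solKW a b k ξ) :=
  (hb.integralSolution_volterraSol 1 0 ξ).add_const_mul hb (hb.integralSolution_volterraSol 0 1 ξ) _

theorem solK_zero (k ξ : ℂ) : solK a b k ξ 0 = 1 := by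
  simp [solK, volterraSol_zero]

theorem solKW_zero (k ξ : ℂ) : solKW a b k ξ 0 = -k := by
  simp [solKW, volterraSolW_zero]

theorem LocalCoeff.solK_truncK (hb : LocalCoeff a α b T) (hξ : 0 < ξ.re) (hT : 0 < T) :
    solK a b (truncK a b T ξ) ξ T = 0 := by
  have := hb.volterraSol_ne_zero hξ hT
  rw [solK, truncK]
  field_simp
  ring

/-- The flux is monotone, zero at `T`, and equal to `-Re(k/ξ)` at `0`. -/
theorem LocalCoeff.re_truncK_div_nonneg (hb : LocalCoeff a α b T) (hξ : 0 < ξ.re) (hT : 0 < T) :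
    0 ≤ (truncK a b T ξ / ξ).re := by
  have h := (hb.integralSolution_solK (truncK a b T ξ) ξ).monotoneOn_flux hb hξ
    ⟨le_rfl, hT.le⟩ ⟨hT.le, le_rfl⟩ hT.le
  rw [flux_eq_zero (hb.solK_truncK hξ hT)] at h
  simp only [flux, weight, primB, solK_zero, solKW_zero, expB_zero_right,
    intervalIntegral.integral_same] at h
  simp only [mul_zero, Real.exp_zero, Complex.ofReal_one, map_one, mul_one, one_mul, neg_div,
    Complex.neg_re] at h
  linarith

theorem LocalCoeff.differentiableOn_truncK_div (hb : LocalCoeff a α b T) (hT : 0 < T) :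
    DifferentiableOn ℂ (fun ξ => truncK a b T ξ / ξ) {z : ℂ | 0 < z.re} := by
  have mT : T ∈ Icc 0 T := ⟨hT.le, le_rfl⟩
  refine DifferentiableOn.div (DifferentiableOn.div
    (hb.differentiable_volterraSol 1 0 mT).differentiableOn
    (hb.differentiable_volterraSol 0 1 mT).differentiableOn
    fun ξ hξ => hb.volterraSol_ne_zero hξ hT) differentiableOn_id fun ξ hξ h => ?_
  have h' : ξ = 0 := h
  simp [h'] at hξ

end RogersODE

namespace RogersODE

/-! ### Convex functions on `[0, R)` -/

/-- The slopes to the left and to the right of `y` are separated by `q y`. Monotonicity of `q`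
suffices; the flux may jump at atoms of `a`. -/
theorem convexOn_of_sub_eq_integral {s : Set ℝ} (hs : Convex ℝ s) {f q : ℝ → ℝ}
    (hq : MonotoneOn q s) (h : ∀ x ∈ s, ∀ y ∈ s, x ≤ y → f y - f x = ∫ u in x..y, q u) :
    ConvexOn ℝ s f := by
  have hoc := hs.ordConnected
  have hint : ∀ x ∈ s, ∀ y ∈ s, IntervalIntegrable q volume x y := fun x hx y hy =>
    (hq.mono (hoc.uIcc_subset hx hy)).intervalIntegrable
  refine convexOn_of_slope_mono_adjacent hs fun {x y z} hx hz hxy hyz => ?_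
  have hy : y ∈ s := hoc.out hx hz ⟨hxy.le, hyz.le⟩
  have h1 : f y - f x ≤ (y - x) * q y := by
    rw [h x hx y hy hxy.le]
    have := intervalIntegral.integral_mono_on hxy.le (hint x hx y hy)
      (intervalIntegrable_const (c := q y)) fun u hu => hq (hoc.out hx hy hu) hy hu.2
    simpa using this
  have h2 : (z - y) * q y ≤ f z - f y := by
    rw [h y hy z hz hyz.le]
    have := intervalIntegral.integral_mono_on hyz.le (intervalIntegrable_const (c := q y))
      (hint y hy z hz) fun u hu => hq hy (hoc.out hy hz hu) hu.1
    simpa using this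
  have p1 : 0 < y - x := sub_pos.2 hxy
  have p2 : 0 < z - y := sub_pos.2 hyz
  calc (f y - f x) / (y - x) ≤ q y := by rw [div_le_iff₀ p1]; linarith
    _ ≤ (f z - f y) / (z - y) := by rw [le_div_iff₀ p2]; linarith

theorem exists_lt_of_not_antitoneOn {f : ℝ → ℝ} {s : Set ℝ} (h : ¬ AntitoneOn f s) :
    ∃ x ∈ s, ∃ y ∈ s, x < y ∧ f x < f y := by
  simp only [AntitoneOn] at h
  push Not at h
  obtain ⟨x, hx, y, hy, hxy, hf⟩ := h
  refine ⟨x, hx, y, hy, lt_of_le_of_ne hxy ?_, hf⟩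
  rintro rfl
  exact lt_irrefl _ hf

theorem ConvexOn.add_slope_mul_le {f : ℝ → ℝ} {s : Set ℝ} (hf : ConvexOn ℝ s f) {x y z : ℝ}
    (hx : x ∈ s) (hz : z ∈ s) (hxy : x < y) (hyz : y < z) :
    f y + (f y - f x) / (y - x) * (z - y) ≤ f z := by
  have := hf.slope_mono_adjacent hx hz hxy hyz
  have p2 : 0 < z - y := sub_pos.2 hyz
  rw [le_div_iff₀ p2] at this
  linarith

variable {R : EReal} {φ : ℝ → ℂ}

theorem eventually_mem_dom {r t : ℝ} (ht : t ∈ dom (r : EReal)) :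
    ∀ᶠ u in 𝓝[<] r, u ∈ dom (r : EReal) ∧ t < u := by
  have htr : t < r := EReal.coe_lt_coe_iff.1 ht.2
  filter_upwards [Ioo_mem_nhdsLT htr] with u hu
  exact ⟨⟨ht.1.trans hu.1.le, EReal.coe_lt_coe_iff.2 hu.2⟩, hu.1⟩

theorem tendsto_atTop_of_not_antitoneOn (hf : ConvexOn ℝ (dom ⊤) fun t => ‖φ t‖ ^ 2)
    (h : ¬ AntitoneOn (fun t => ‖φ t‖ ^ 2) (dom ⊤)) : Tendsto (fun t => ‖φ t‖ ^ 2) atTop atTop := by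
  obtain ⟨x, hx, y, hy, hxy, hlt⟩ := exists_lt_of_not_antitoneOn h
  have hpos : 0 < (‖φ y‖ ^ 2 - ‖φ x‖ ^ 2) / (y - x) := div_pos (sub_pos.2 hlt) (sub_pos.2 hxy)
  refine tendsto_atTop_mono' _ (f₁ := fun z =>
    ‖φ y‖ ^ 2 + (‖φ y‖ ^ 2 - ‖φ x‖ ^ 2) / (y - x) * (z - y)) ?_ ?_
  · filter_upwards [eventually_gt_atTop y] with z hz
    exact ConvexOn.add_slope_mul_le hf hx ⟨hy.1.trans hz.le, EReal.coe_lt_top z⟩ hxy hz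
  · exact tendsto_atTop_add_const_left _ _
      ((tendsto_atTop_add_const_right _ (-y) tendsto_id).const_mul_atTop hpos)

theorem eventually_le_of_not_antitoneOn {r : ℝ}
    (hf : ConvexOn ℝ (dom (r : EReal)) fun t => ‖φ t‖ ^ 2)
    (h : ¬ AntitoneOn (fun t => ‖φ t‖ ^ 2) (dom (r : EReal))) :
    ∃ δ > 0, ∀ᶠ t in 𝓝[<] r, δ ≤ ‖φ t‖ := by
  obtain ⟨x, hx, y, hy, hxy, hlt⟩ := exists_lt_of_not_antitoneOn h
  have hlt' : ‖φ x‖ ^ 2 < ‖φ y‖ ^ 2 := hlt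
  have hpos : 0 < (‖φ y‖ ^ 2 - ‖φ x‖ ^ 2) / (y - x) := div_pos (sub_pos.2 hlt') (sub_pos.2 hxy)
  refine ⟨‖φ y‖, lt_of_le_of_ne (norm_nonneg _) fun e => ?_, ?_⟩
  · rw [← e] at hlt'
    nlinarith [sq_nonneg ‖φ x‖]
  · filter_upwards [eventually_mem_dom hy] with z hz
    have h1 := ConvexOn.add_slope_mul_le hf hx hz.1 hxy hz.2
    have h2 := mul_pos hpos (sub_pos.2 hz.2)
    refine (abs_le_of_sq_le_sq' ?_ (norm_nonneg _)).2
    linarith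

theorem antitoneOn_of_vanishesOrBounded (hR : 0 < R)
    (hf : ConvexOn ℝ (dom R) fun t => ‖φ t‖ ^ 2) (h : VanishesOrBounded R φ) :
    AntitoneOn (fun t => ‖φ t‖ ^ 2) (dom R) := by
  by_contra hna
  induction R with
  | bot => simp at hR
  | top =>
    obtain ⟨C, hC⟩ := h.1 rfl
    obtain ⟨t, h0, h1⟩ := ((eventually_ge_atTop (0 : ℝ)).and
      ((tendsto_atTop_of_not_antitoneOn hf hna).eventually_gt_atTop (C ^ 2))).exists
    have := pow_le_pow_left₀ (norm_nonneg _) (hC t ⟨h0, EReal.coe_lt_top t⟩) 2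
    linarith
  | coe r =>
    obtain ⟨δ, hδ, hev⟩ := eventually_le_of_not_antitoneOn hf hna
    have hl := (h.2 r rfl).norm
    have := ge_of_tendsto hl hev
    simp at this
    linarith

/-- If `|φ|²` increases somewhere, convexity forces the first alternative. Otherwise `|φ|` is
non-increasing, hence bounded, and for finite `R` it either has a positive lower bound or tends to
`0`. -/
theorem divergesOrAwayFromZero_or_vanishesOrBounded (hR : 0 < R)
    (hf : ConvexOn ℝ (dom R) fun t => ‖φ t‖ ^ 2) :
    DivergesOrAwayFromZero R φ ∨ VanishesOrBounded R φ := by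
  by_cases hna : AntitoneOn (fun t => ‖φ t‖ ^ 2) (dom R)
  · have h0 := zero_mem_dom hR
    have hle : ∀ s ∈ dom R, ∀ t ∈ dom R, s ≤ t → ‖φ t‖ ≤ ‖φ s‖ := fun s hs t ht hst =>
      (abs_le_of_sq_le_sq' (hna hs ht hst) (norm_nonneg _)).2
    by_cases hδ : ∃ δ > 0, ∀ t ∈ dom R, δ ≤ ‖φ t‖
    · obtain ⟨δ, hδ, h⟩ := hδ
      induction R with
      | bot => simp at hR
      | top =>
        exact Or.inr ⟨fun _ => ⟨‖φ 0‖, fun t ht => hle 0 h0 t ht ht.1⟩, fun r e => by simp at e⟩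
      | coe r =>
        refine Or.inl ⟨fun e => by simp at e, fun r' e => ⟨δ, hδ, ?_⟩⟩
        obtain rfl := EReal.coe_eq_coe_iff.1 e
        filter_upwards [eventually_mem_dom h0] with t ht
        exact h t ht.1
    · push Not at hδ
      refine Or.inr ⟨fun _ => ⟨‖φ 0‖, fun t ht => hle 0 h0 t ht ht.1⟩, fun r e => ?_⟩
      subst e
      rw [Metric.tendsto_nhds]
      intro ε hε
      obtain ⟨t, ht, hlt⟩ := hδ ε hε
      filter_upwards [eventually_mem_dom ht] with u hu
      rw [dist_zero_right]
      exact (hle t ht u hu.1 hu.2.le).trans_lt hlt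
  · left
    induction R with
    | bot => simp at hR
    | top =>
      refine ⟨fun _ => ?_, fun r e => by simp at e⟩
      have := tendsto_atTop_of_not_antitoneOn hf hna
      refine (Real.tendsto_sqrt_atTop.comp this).congr fun t => ?_
      simp [Function.comp]
    | coe r =>
      refine ⟨fun e => by simp at e, fun r' e => ?_⟩
      obtain rfl := EReal.coe_eq_coe_iff.1 e
      exact eventually_le_of_not_antitoneOn hf hna

theorem VanishesOrBounded.add_const_mul {ψ : ℝ → ℂ} (h₁ : VanishesOrBounded R φ)
    (h₂ : VanishesOrBounded R ψ) (c : ℂ) : VanishesOrBounded R fun t => φ t + c * ψ t := by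
  refine ⟨fun e => ?_, fun r e => ?_⟩
  · obtain ⟨C, hC⟩ := h₁.1 e
    obtain ⟨D, hD⟩ := h₂.1 e
    refine ⟨C + ‖c‖ * D, fun t ht => (norm_add_le _ _).trans ?_⟩
    rw [norm_mul]
    gcongr
    · exact hC t ht
    · exact hD t ht
  · simpa using (h₁.2 r e).add ((h₂.2 r e).const_mul c)

/-! ### Solutions for real `ξ` -/

variable {a α : Measure ℝ} {b : ℝ → ℝ} {T ξ : ℝ} {w : ℝ → ℂ}

theorem weight_ofReal (b : ℝ → ℝ) (ξ t : ℝ) : weight b ξ t = 1 := by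
  simp [weight]

theorem flux_ofReal (b : ℝ → ℝ) (ξ : ℝ) (φ w : ℝ → ℂ) (t : ℝ) : flux b ξ φ w t =
    ((starRingEnd ℂ) (φ t) * (expB b (-(2 * Complex.I * ξ)) t * w t)).re / ξ := by
  rw [flux, weight_ofReal, Complex.ofReal_one, one_mul, Complex.div_ofReal_re]

theorem norm_expB_eq_one (b : ℝ → ℝ) {c : ℂ} (hc : c.re = 0) (t : ℝ) : ‖expB b c t‖ = 1 := by
  simp [expB, Complex.norm_exp, hc]

/-- For real `ξ` the weight is `1`, and `2ξ` times the flux is `2 Re(φ̄ φ')`, the density of `|φ|²`.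
-/
theorem IntegralSolution.normSq_sub (hb : LocalCoeff a α b T)
    (h : IntegralSolution a b T ξ φ w) (hξ : 0 < ξ) {s t : ℝ} (hs : s ∈ Icc 0 T)
    (ht : t ∈ Icc 0 T) : ‖φ t‖ ^ 2 - ‖φ s‖ ^ 2 = ∫ u in s..t, 2 * ξ * flux b ξ φ w u := by
  have hp := (h.hasPrim hb).mul hb.nonneg (h.hasPrim hb).star
  have e := hp.sub_eq hs ht
  simp only [Complex.mul_conj'] at e
  have e2 : ∀ u, expB b (-(2 * Complex.I * ξ)) u * w u * (starRingEnd ℂ) (φ u)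
      + φ u * (starRingEnd ℂ) (expB b (-(2 * Complex.I * ξ)) u * w u)
      = ((2 * ξ * flux b ξ φ w u : ℝ) : ℂ) := by
    intro u
    have h1 := Complex.add_conj (expB b (-(2 * Complex.I * ξ)) u * w u * (starRingEnd ℂ) (φ u))
    rw [map_mul, Complex.conj_conj] at h1
    rw [mul_comm (φ u), h1, flux_ofReal, mul_comm (starRingEnd ℂ (φ u))]
    congr 1
    field_simp
  simp only [e2] at e
  rw [intervalIntegral.integral_ofReal] at e
  exact_mod_cast e

/-- The function `w` has non-increasing modulus if it makes an obtuse angle with its increments. -/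
theorem norm_le_of_re_increment_nonpos (ha : a (Icc 0 T) < ⊤) {h : ℝ → ℂ}
    (hh : ContinuousOn h (Icc 0 T))
    (hw : ∀ x ∈ Icc 0 T, ∀ y ∈ Icc 0 T, x ≤ y → w y - w x = ∫ u in Ico x y, h u ∂a)
    (hre : ∀ u ∈ Icc 0 T, (h u * (starRingEnd ℂ) (w u)).re ≤ 0) {s : ℝ} (hs : s ∈ Icc 0 T) :
    ‖w T‖ ≤ ‖w s‖ := by
  have hT : 0 ≤ T := hs.1.trans hs.2
  have mT : T ∈ Icc 0 T := ⟨hT, le_rfl⟩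
  have m0 : (0 : ℝ) ∈ Icc 0 T := ⟨le_rfl, hT⟩
  have hhi := integrableOn_of_continuousOn ha hh
  have hfin : ∀ x ∈ Icc 0 T, ∀ y ∈ Icc 0 T, a (Ico x y) < ⊤ := fun x hx y hy =>
    (measure_mono (Ico_subset_Icc_self.trans (Icc_subset_Icc hx.1 hy.2))).trans_lt ha
  set m : ℝ → ℝ := fun x => a.real (Ico 0 x) with hm
  have hadd : ∀ x ∈ Icc 0 T, ∀ y ∈ Icc 0 T, x ≤ y → a.real (Ico x y) = m y - m x := by
    intro x hx y hy hxy
    simp only [hm]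
    rw [← Ico_union_Ico_eq_Ico hx.1 hxy, measureReal_union
      (Set.disjoint_left.2 fun u h1 h2 => absurd h1.2 (not_lt.2 h2.1)) measurableSet_Ico
      (hfin 0 m0 x hx).ne (hfin x hx y hy).ne]
    ring
  obtain ⟨H, hH⟩ := isCompact_Icc.exists_bound_of_continuousOn hh
  have hH0 : 0 ≤ H := (norm_nonneg _).trans (hH 0 m0)
  obtain ⟨M, hM0, hM⟩ : ∃ M : ℝ, 0 ≤ M ∧ ∀ u ∈ Icc 0 T, ‖w u‖ ≤ M := by
    refine ⟨‖w 0‖ + H * a.real (Icc 0 T), by positivity, fun u hu => ?_⟩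
    have e := hw 0 m0 u hu hu.1
    have : w u = w 0 + ∫ u in Ico 0 u, h u ∂a := by rw [← e]; ring
    rw [this]
    have hsub : Ico 0 u ⊆ Icc 0 T := fun r hr => ⟨hr.1, hr.2.le.trans hu.2⟩
    refine (norm_add_le _ _).trans ?_
    gcongr
    refine (norm_setIntegral_le_of_norm_le_const (hfin 0 m0 u hu) fun r hr => hH r (hsub hr)).trans ?_
    gcongr
    exact ha.ne
  -- On a short interval `h` is replaced by its value at `z`, where the sign hypothesis applies; the
  -- oscillation of `h` costs at most `ε`.
  have hcross : ∀ ε > 0, ∀ x ∈ Icc 0 T, ∀ y ∈ Icc 0 T, x ≤ y → ∀ z ∈ Icc 0 T,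
      (∀ u ∈ Ico x y, ‖h u - h z‖ ≤ ε) →
      ((w y - w x) * (starRingEnd ℂ) (w z)).re ≤ ε * (m y - m x) * M := by
    intro ε hε x hx y hy hxy z hz hu
    have hi : IntegrableOn h (Ico x y) a := integrableOn_Ico_of_Icc hhi hx.1 hy.2
    have hcst : IntegrableOn (fun _ => h z) (Ico x y) a :=
      integrableOn_const (hfin x hx y hy).ne
    have e : w y - w x = (∫ u in Ico x y, (h u - h z) ∂a) + (a.real (Ico x y) : ℂ) * h z := by
      rw [integral_sub hi hcst, hw x hx y hy hxy, setIntegral_const, Complex.real_smul]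
      ring
    have h1 : ‖∫ u in Ico x y, (h u - h z) ∂a‖ ≤ ε * a.real (Ico x y) :=
      norm_setIntegral_le_of_norm_le_const (hfin x hx y hy) hu
    rw [e, add_mul, Complex.add_re, mul_assoc, Complex.re_ofReal_mul, ← hadd x hx y hy hxy]
    have h2 : ((∫ u in Ico x y, (h u - h z) ∂a) * (starRingEnd ℂ) (w z)).re
        ≤ ε * a.real (Ico x y) * M := by
      refine (Complex.re_le_norm _).trans ?_
      rw [norm_mul, Complex.norm_conj]
      gcongr
      exact hM z hz
    have h3 := mul_nonpos_of_nonneg_of_nonpos (measureReal_nonneg (μ := a) (s := Ico x y)) (hre z hz)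
    linarith
  have hstep : ∀ ε > 0, ∀ x ∈ Icc 0 T, ∀ y ∈ Icc 0 T, x ≤ y →
      (∀ u ∈ Icc x y, ∀ v ∈ Icc x y, ‖h u - h v‖ ≤ ε) →
      ‖w y‖ ^ 2 - 2 * ε * M * m y ≤ ‖w x‖ ^ 2 - 2 * ε * M * m x := by
    intro ε hε x hx y hy hxy hu
    have h1 := hcross ε hε x hx y hy hxy x hx fun u hu' =>
      hu u ⟨hu'.1, hu'.2.le⟩ x ⟨le_rfl, hxy⟩
    have h2 := hcross ε hε x hx y hy hxy y hy fun u hu' =>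
      hu u ⟨hu'.1, hu'.2.le⟩ y ⟨hxy, le_rfl⟩
    -- Pairing the increment with both endpoint values leaves no term `|w y - w x|²`. Such a term
    -- need not be small, because `w` jumps at atoms.
    have h3 : ‖w y‖ ^ 2 - ‖w x‖ ^ 2 = ((w y - w x) * (starRingEnd ℂ) (w x)).re
        + ((w y - w x) * (starRingEnd ℂ) (w y)).re := by
      simp only [← Complex.normSq_eq_norm_sq, Complex.normSq_apply, Complex.mul_re, Complex.sub_re,
        Complex.sub_im, Complex.conj_re, Complex.conj_im]
      ring
    linarith
  -- Telescoping over a uniform partition finer than the modulus of continuity of `h`; the errors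
  -- add up to a multiple of `ε`.
  have hε : ∀ ε > 0, ‖w T‖ ^ 2 - 2 * ε * M * m T ≤ ‖w s‖ ^ 2 - 2 * ε * M * m s := by
    intro ε hε
    have huc := isCompact_Icc.uniformContinuousOn_of_continuous hh
    rw [Metric.uniformContinuousOn_iff_le] at huc
    obtain ⟨δ, hδ, huc⟩ := huc ε hε
    obtain ⟨N, hN⟩ := exists_nat_gt ((T - s) / δ)
    have hN0 : (0 : ℝ) < N := lt_of_le_of_lt (div_nonneg (sub_nonneg.2 hs.2) hδ.le) hN
    set d := (T - s) / N with hd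
    have hd0 : 0 ≤ d := div_nonneg (sub_nonneg.2 hs.2) hN0.le
    have hdδ : d ≤ δ := by
      rw [hd, div_le_iff₀ hN0]
      rw [div_lt_iff₀ hδ] at hN
      linarith
    have hNd : N * d = T - s := by rw [hd]; field_simp
    have hmem : ∀ i : ℕ, i ≤ N → s + i * d ∈ Icc 0 T := by
      intro i hi
      have : (i : ℝ) ≤ N := by exact_mod_cast hi
      have h1 : i * d ≤ N * d := by gcongr
      have h2 : 0 ≤ i * d := by positivity
      exact ⟨by linarith [hs.1], by linarith⟩
    have hind : ∀ i : ℕ, i ≤ N → ‖w (s + i * d)‖ ^ 2 - 2 * ε * M * m (s + i * d)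
        ≤ ‖w s‖ ^ 2 - 2 * ε * M * m s := by
      intro i
      induction i with
      | zero => intro _; simp
      | succ i ih =>
        intro hi
        have hx := hmem i (by omega)
        have hy := hmem (i + 1) hi
        have hxy : s + i * d ≤ s + (i + 1 : ℕ) * d := by
          push_cast
          linarith
        refine (hstep ε hε _ hx _ hy hxy fun u hu v hv => ?_).trans (ih (by omega))
        have hlen : s + (i + 1 : ℕ) * d - (s + i * d) = d := by push_cast; ring
        rw [← dist_eq_norm]
        refine huc u ⟨hx.1.trans hu.1, hu.2.trans hy.2⟩ v ⟨hx.1.trans hv.1, hv.2.trans hy.2⟩ ?_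
        rw [Real.dist_eq, abs_le]
        constructor <;> linarith [hu.1, hu.2, hv.1, hv.2]
    have := hind N le_rfl
    rwa [show s + (N : ℝ) * d = T by linarith] at this
  have hsq : ‖w T‖ ^ 2 ≤ ‖w s‖ ^ 2 := by
    refine le_of_forall_pos_le_add fun η hη => ?_
    have hK : 0 ≤ 2 * M * (m T - m s) := by
      have := hadd s hs T mT hs.2
      rw [← this]
      positivity
    have h1 := hε (η / (2 * M * (m T - m s) + 1)) (by positivity)
    have h2 : η / (2 * M * (m T - m s) + 1) * (2 * M * (m T - m s)) ≤ η := by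
      rw [div_mul_eq_mul_div, div_le_iff₀ (by positivity)]
      nlinarith
    linarith
  exact (abs_le_of_sq_le_sq' hsq (norm_nonneg _)).2

end RogersODE

namespace RogersODE

/-! ### Solutions on `[0, R)` -/

variable {R : EReal} {a : Measure ℝ} {b : ℝ → ℝ} {ξ : ℝ} {φ w : ℝ → ℂ}

theorem exists_gt_mem_dom (hR : 0 < R) {t : ℝ} (ht : t ∈ dom R) : ∃ u ∈ dom R, t < u := by
  obtain ⟨τ, -, h1, h2⟩ := exists_exhaustion hR
  obtain ⟨n, hn⟩ := (h2 t ht).exists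
  exact ⟨τ n, (h1 n).2, hn⟩

theorem monotoneOn_flux_dom (hab : Coefficients R a b) (hξ : 0 < ξ)
    (h : ∀ T ∈ dom R, IntegralSolution a b T ξ φ w) : MonotoneOn (flux b ξ φ w) (dom R) :=
  fun _ hs t ht hst => (h t ht).monotoneOn_flux (hab.localCoeff ht) (by simpa using hξ)
    ⟨hs.1, hst⟩ ⟨ht.1, le_rfl⟩ hst

theorem normSq_sub_dom (hab : Coefficients R a b) (hξ : 0 < ξ)
    (h : ∀ T ∈ dom R, IntegralSolution a b T ξ φ w) {s t : ℝ} (hs : s ∈ dom R) (ht : t ∈ dom R)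
    (hst : s ≤ t) : ‖φ t‖ ^ 2 - ‖φ s‖ ^ 2 = ∫ u in s..t, 2 * ξ * flux b ξ φ w u :=
  (h t ht).normSq_sub (hab.localCoeff ht) hξ ⟨hs.1, hst⟩ ⟨ht.1, le_rfl⟩

theorem convexOn_normSq (hab : Coefficients R a b) (hξ : 0 < ξ)
    (h : ∀ T ∈ dom R, IntegralSolution a b T ξ φ w) :
    ConvexOn ℝ (dom R) fun t => ‖φ t‖ ^ 2 := by
  refine convexOn_of_sub_eq_integral (ordConnected_dom R).convex
    (q := fun u => 2 * ξ * flux b ξ φ w u) (fun s hs t ht hst => ?_)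
    fun s hs t ht hst => normSq_sub_dom hab hξ h hs ht hst
  exact mul_le_mul_of_nonneg_left (monotoneOn_flux_dom hab hξ h hs ht hst) (by positivity)

/-- A solution which vanishes at `0` and satisfies the boundary condition at `R` is zero. -/
theorem eq_zero_of_vanishesOrBounded (hab : Coefficients R a b) (hξ : 0 < ξ)
    (h : ∀ T ∈ dom R, IntegralSolution a b T ξ φ w) (hv : VanishesOrBounded R φ) (h0 : φ 0 = 0) :
    (∀ t ∈ dom R, φ t = 0) ∧ ∀ t ∈ dom R, w t = 0 := by
  have hanti := antitoneOn_of_vanishesOrBounded hab.R_pos (convexOn_normSq hab hξ h) hv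
  have hφ : ∀ t ∈ dom R, φ t = 0 := by
    intro t ht
    have := hanti (zero_mem_dom hab.R_pos) ht ht.1
    simp only [h0, norm_zero, ne_eq, OfNat.ofNat_ne_zero, not_false_eq_true, zero_pow] at this
    exact norm_eq_zero.1 (pow_eq_zero_iff two_ne_zero |>.1 (le_antisymm this (sq_nonneg _)))
  refine ⟨hφ, fun t ht => ?_⟩
  obtain ⟨T, hT, hT0⟩ := exists_gt_mem_dom hab.R_pos (zero_mem_dom hab.R_pos)
  have hw0 := (h T hT).w_zero_eq_zero (hab.localCoeff hT) (by simpa using hξ) hT0 h0 (hφ T hT)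
  rw [(h t ht).w_eq t ⟨ht.1, le_rfl⟩, hw0, setIntegral_eq_zero_of_forall_eq_zero fun u hu => by
    rw [hφ u (Icc_subset_dom ht ⟨hu.1, hu.2.le⟩), mul_zero]]
  simp

/-- A positive flux would stay at least as large to the right of `t`, and `|φ|²` would increase. -/
theorem flux_nonpos (hab : Coefficients R a b) (hξ : 0 < ξ)
    (h : ∀ T ∈ dom R, IntegralSolution a b T ξ φ w)
    (hanti : AntitoneOn (fun t => ‖φ t‖ ^ 2) (dom R)) {t : ℝ} (ht : t ∈ dom R) :
    flux b ξ φ w t ≤ 0 := by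
  by_contra hpos
  push Not at hpos
  obtain ⟨u, hu, htu⟩ := exists_gt_mem_dom hab.R_pos ht
  have hmono := monotoneOn_flux_dom hab hξ h
  have hoc := ordConnected_dom R
  have e := normSq_sub_dom hab hξ h ht hu htu.le
  have hint : IntervalIntegrable (fun u => 2 * ξ * flux b ξ φ w u) volume t u :=
    (hmono.mono (hoc.uIcc_subset ht hu)).intervalIntegrable.const_mul _
  have h1 := intervalIntegral.integral_mono_on htu.le
    (intervalIntegrable_const (c := 2 * ξ * flux b ξ φ w t)) hint fun r hr =>
      mul_le_mul_of_nonneg_left (hmono ht (hoc.out ht hu hr) hr.1) (by positivity)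
  rw [intervalIntegral.integral_const, smul_eq_mul, ← e] at h1
  have h2 := hanti ht hu htu.le
  simp only at h2
  have h3 : 0 < (u - t) * (2 * ξ * flux b ξ φ w t) :=
    mul_pos (sub_pos.2 htu) (by positivity)
  linarith

/-- For real `ξ` the exponential factor is unimodular, so `|φ'| = |w|`. The density of `dw` pairs
with `w` to give `ξ³` times the flux, which is non-positive. -/
theorem antitoneOn_norm_deriv (hab : Coefficients R a b) (hξ : 0 < ξ)
    (h : ∀ T ∈ dom R, IntegralSolution a b T ξ φ w)
    (hanti : AntitoneOn (fun t => ‖φ t‖ ^ 2) (dom R)) :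
    AntitoneOn (fun t => ‖expB b (-(2 * Complex.I * ξ)) t * w t‖) (dom R) := by
  intro s hs t ht hst
  have hb := hab.localCoeff ht
  simp only [norm_mul]
  rw [norm_expB_eq_one b (by simp), norm_expB_eq_one b (by simp), one_mul, one_mul]
  refine norm_le_of_re_increment_nonpos (a := a)
    (h := fun u => (ξ : ℂ) ^ 2 * (expB b (2 * Complex.I * ξ) u * φ u)) hb.finite
    (continuousOn_const.mul ((hb.continuousOn_expB _).mul (h t ht).cont)) ?_ ?_ ⟨hs.1, hst⟩
  · intro x hx y hy hxy
    rw [(h t ht).w_eq y hy, (h t ht).w_eq x hx, integral_const_mul,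
      ← integral_Ico_sub ((h t ht).integrableOn hb) hx.1 hxy hy.2]
    ring
  · intro u hu
    have hf := flux_nonpos hab hξ h hanti (Icc_subset_dom ht hu)
    rw [flux_ofReal, div_nonpos_iff] at hf
    have hf' : ((starRingEnd ℂ) (φ u) * (expB b (-(2 * Complex.I * ξ)) u * w u)).re ≤ 0 := by
      rcases hf with hf | hf
      · linarith [hf.2]
      · exact hf.1
    have hc : (starRingEnd ℂ) (expB b (2 * Complex.I * ξ) u) = expB b (-(2 * Complex.I * ξ)) u := by
      simp only [expB, ← Complex.exp_conj, map_mul, map_ofNat, Complex.conj_I,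
        Complex.conj_ofReal]
      congr 1
      ring
    have e : (ξ : ℂ) ^ 2 * (expB b (2 * Complex.I * ξ) u * φ u) * (starRingEnd ℂ) (w u) =
        ((ξ ^ 2 : ℝ) : ℂ) * (starRingEnd ℂ)
          ((starRingEnd ℂ) (φ u) * (expB b (-(2 * Complex.I * ξ)) u * w u)) := by
      rw [← hc]
      simp only [map_mul, Complex.conj_conj]
      push_cast
      ring
    rw [e, Complex.re_ofReal_mul, Complex.conj_re]
    exact mul_nonpos_of_nonneg_of_nonpos (sq_nonneg ξ) hf'

/-- Since the modulus is non-increasing, a zero persists to its right, so `φ` and `w` vanish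
together at some point. The Wronskian with the solution having data `(0, 1)` is `1`, a
contradiction. -/
theorem solK_ne_zero (hab : Coefficients R a b) {k : ℂ}
    (hanti : AntitoneOn (fun t => ‖solK a b k ξ t‖ ^ 2) (dom R)) {t : ℝ} (ht : t ∈ dom R) :
    solK a b k ξ t ≠ 0 := by
  intro h0
  obtain ⟨T, hT, htT⟩ := exists_gt_mem_dom hab.R_pos ht
  have hb := hab.localCoeff hT
  have hz : ∀ u ∈ Icc t T, solK a b k ξ u = 0 := by
    intro u hu
    have := hanti ht (Icc_subset_dom hT ⟨ht.1.trans hu.1, hu.2⟩) hu.1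
    simp only [h0, norm_zero, ne_eq, OfNat.ofNat_ne_zero, not_false_eq_true, zero_pow] at this
    exact norm_eq_zero.1 (pow_eq_zero_iff two_ne_zero |>.1 (le_antisymm this (sq_nonneg _)))
  have hsol := hb.integralSolution_solK k ξ
  have hS := hb.integralSolution_volterraSol 0 1 ξ
  have : NeBot (ae (volume.restrict (Ioo t T))) := by
    rw [ae_neBot, Ne, Measure.restrict_eq_zero, Real.volume_Ioo]
    simpa using htT
  obtain ⟨u, hd, hu⟩ := ((ae_restrict_of_ae ((hsol.hasPrim hb).ae_hasDerivAt hb.nonneg)).and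
    (ae_restrict_mem (measurableSet_Ioo (a := t) (b := T)))).exists
  have hu' : u ∈ Icc 0 T := ⟨ht.1.trans hu.1.le, hu.2.le⟩
  have hd0 : HasDerivAt (solK a b k ξ) 0 u := by
    refine (hasDerivAt_const u (0 : ℂ)).congr_of_eventuallyEq ?_
    filter_upwards [Ioo_mem_nhds hu.1 hu.2] with v hv
    exact hz v ⟨hv.1.le, hv.2.le⟩
  have hw := (hd hu').unique hd0
  have hw0 := (mul_eq_zero.1 hw).resolve_left (expB_ne_zero _ _ _)
  have hW := hsol.wronskian hb hS hu'
  rw [hz u ⟨hu.1.le, hu.2.le⟩, hw0, solK_zero, volterraSolW_zero, volterraSol_zero] at hW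
  simp at hW

/-- The truncated energy identity as an estimate for extended non-negative integrals. -/
theorem truncated_energy_le (hab : Coefficients R a b) (hξ : 0 < ξ)
    (h : ∀ T ∈ dom R, IntegralSolution a b T ξ φ w)
    (hanti : AntitoneOn (fun t => ‖φ t‖ ^ 2) (dom R)) {t T : ℝ} (ht : t ∈ dom R) (hT : T ∈ dom R)
    (htT : t ≤ T) :
    ENNReal.ofReal (ξ ^ 2) *
        (∫⁻ s in Ico t T, ENNReal.ofReal (‖tildePhi b ξ φ s‖ ^ 2) ∂(tildeA R a b))
      + ∫⁻ s in Ico t T, ENNReal.ofReal (‖deriv (tildePhi b ξ φ) s‖ ^ 2)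
      ≤ ENNReal.ofReal (-(ξ * flux b ξ φ w t)) := by
  have hb := hab.localCoeff hT
  have mt : t ∈ Icc 0 T := ⟨ht.1, htT⟩
  have mT : T ∈ Icc 0 T := ⟨hT.1, le_rfl⟩
  have hsol := h T hT
  have hξ' : 0 < (ξ : ℂ).re := by simpa using hξ
  obtain ⟨hi, he⟩ := hsol.energy_identity hb hξ'
  have e := he t mt T mT htT
  simp only [weight_ofReal, one_mul, Complex.ofReal_re, Complex.norm_real, Real.norm_eq_abs,
    sq_abs] at e
  have htp : tildePhi b ξ φ = fun s => expB b (Complex.I * ξ) s * φ s := rfl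
  have e1 : (∫⁻ s in Ico t T, ENNReal.ofReal (‖tildePhi b ξ φ s‖ ^ 2) ∂(tildeA R a b)) =
      ENNReal.ofReal (∫ s in Ico t T, ‖φ s‖ ^ 2 ∂(tildeA R a b)) := by
    rw [ofReal_integral_eq_lintegral_ofReal
      (hb.split (fun s => ‖φ s‖ ^ 2) (hsol.cont.norm.pow 2) t mt T mT htT).1
      (Eventually.of_forall fun s => sq_nonneg _)]
    refine lintegral_congr fun s => ?_
    rw [htp, norm_mul, norm_expB_eq_one b (by simp), one_mul]
  have hder : ∀ᵐ s ∂volume.restrict (Ico t T),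
      ‖deriv (tildePhi b ξ φ) s‖ ^ 2 = tildeDensity b ξ φ w s := by
    have := ((hb.hasPrim_expB (Complex.I * ξ)).mul hb.nonneg (hsol.hasPrim hb)).ae_hasDerivAt
      hb.nonneg
    refine (ae_restrict_iff' measurableSet_Ico).2 ?_
    filter_upwards [this] with s hs hst
    rw [htp, (hs ⟨ht.1.trans hst.1, hst.2.le⟩).deriv, tildeDensity, weight_ofReal, one_mul]
    congr 1
    have : Complex.I * ξ * b s * expB b (Complex.I * ξ) s * φ s
        + expB b (Complex.I * ξ) s * (expB b (-(2 * Complex.I * ξ)) s * w s)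
        = expB b (Complex.I * ξ) s * (expB b (-(2 * Complex.I * ξ)) s * w s
          + Complex.I * ξ * b s * φ s) := by ring
    rw [this, norm_mul, norm_expB_eq_one b (by simp), one_mul]
  have e2 : (∫⁻ s in Ico t T, ENNReal.ofReal (‖deriv (tildePhi b ξ φ) s‖ ^ 2)) =
      ENNReal.ofReal (∫ s in t..T, tildeDensity b ξ φ w s) := by
    rw [intervalIntegral.integral_of_le htT, ← integral_Ico_eq_integral_Ioc,
      ofReal_integral_eq_lintegral_ofReal]
    · exact lintegral_congr_ae (hder.mono fun s hs => by simp only [hs])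
    · exact ((intervalIntegrable_iff_integrableOn_Icc_of_le hb.nonneg).1 hi).mono_set
        (Ico_subset_Icc_self.trans (Icc_subset_Icc ht.1 le_rfl))
    · exact Eventually.of_forall fun s => tildeDensity_nonneg _ _ _ _ _
  have p1 : 0 ≤ ∫ s in Ico t T, ‖φ s‖ ^ 2 ∂(tildeA R a b) :=
    integral_nonneg fun s => sq_nonneg _
  have p2 : 0 ≤ ∫ s in t..T, tildeDensity b ξ φ w s :=
    intervalIntegral.integral_nonneg htT fun s _ => tildeDensity_nonneg _ _ _ _ _
  rw [e1, e2, ← ENNReal.ofReal_mul (sq_nonneg ξ), ← ENNReal.ofReal_add (by positivity) p2]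
  refine ENNReal.ofReal_le_ofReal ?_
  -- The boundary term at `T` has a favourable sign, so nothing need be known about its limit.
  have hT0 := mul_nonpos_of_nonneg_of_nonpos hξ.le (flux_nonpos hab hξ h hanti hT)
  have : ξ * (flux b ξ φ w T - flux b ξ φ w t) =
      ξ ^ 2 * (∫ s in Ico t T, ‖φ s‖ ^ 2 ∂(tildeA R a b))
        + ∫ s in t..T, tildeDensity b ξ φ w s := by
    rw [e]
    field_simp
  linarith

theorem energy_le_flux (hab : Coefficients R a b) (hξ : 0 < ξ)
    (h : ∀ T ∈ dom R, IntegralSolution a b T ξ φ w)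
    (hanti : AntitoneOn (fun t => ‖φ t‖ ^ 2) (dom R)) {t : ℝ} (ht : t ∈ dom R) :
    energy R a b ξ φ t ≤ ENNReal.ofReal (-(ξ * flux b ξ φ w t)) := by
  obtain ⟨τ, hmono, h1, h2⟩ := exists_exhaustion hab.R_pos
  have hset : dom R ∩ Ici t = ⋃ n, Ico t (τ n) := by
    ext u
    simp only [mem_inter_iff, mem_Ici, mem_iUnion, mem_Ico]
    constructor
    · rintro ⟨hu, htu⟩
      obtain ⟨n, hn⟩ := (h2 u hu).exists
      exact ⟨n, htu, hn⟩
    · rintro ⟨n, htu, hn⟩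
      exact ⟨Icc_subset_dom (h1 n).2 ⟨ht.1.trans htu, hn.le⟩, htu⟩
  have hsm : Monotone fun n => Ico t (τ n) := fun m n hmn => Ico_subset_Ico_right (hmono hmn)
  have hlim : ∀ (μ : Measure ℝ) (f : ℝ → ENNReal), Tendsto (fun n => ∫⁻ s in Ico t (τ n), f s ∂μ)
      atTop (𝓝 (∫⁻ s in dom R ∩ Ici t, f s ∂μ)) := by
    intro μ f
    rw [hset, setLIntegral_iUnion_of_directed _ hsm.directed_le]
    exact tendsto_atTop_iSup fun m n hmn => lintegral_mono_set (hsm hmn)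
  refine le_of_tendsto ((ENNReal.Tendsto.const_mul (hlim (tildeA R a b) _)
    (Or.inr ENNReal.ofReal_ne_top)).add (hlim volume _)) ?_
  filter_upwards [h2 t ht] with n hn
  exact truncated_energy_le hab hξ h hanti ht (h1 n).2 hn.le

/-- Comparison with the flux at `0` gives the first bound. Integrating monotonicity over `[0, t]`
gives the second, in fact with `1/2` in place of `2`, because `|φ|²` drops by at most `1`. -/
theorem flux_bounds (hab : Coefficients R a b) (hξ : 0 < ξ)
    (h : ∀ T ∈ dom R, IntegralSolution a b T ξ φ w) (h0 : φ 0 = 1) {t : ℝ} (ht : t ∈ dom R) :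
    -(ξ * flux b ξ φ w t) ≤ (-w 0).re ∧ -(ξ * flux b ξ φ w t) * t ≤ 2 := by
  have m0 := zero_mem_dom hab.R_pos
  have hmono := monotoneOn_flux_dom hab hξ h
  refine ⟨?_, ?_⟩
  · have h1 := mul_le_mul_of_nonneg_left (hmono m0 ht ht.1) hξ.le
    have h2 : ξ * flux b ξ φ w 0 = (w 0).re := by
      rw [flux_ofReal, h0, expB_zero_right, map_one, one_mul, one_mul]
      field_simp
    rw [Complex.neg_re]
    linarith
  · have e := normSq_sub_dom hab hξ h m0 ht ht.1
    have hoc := ordConnected_dom R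
    have hint : IntervalIntegrable (fun u => 2 * ξ * flux b ξ φ w u) volume 0 t :=
      (hmono.mono (hoc.uIcc_subset m0 ht)).intervalIntegrable.const_mul _
    have h1 := intervalIntegral.integral_mono_on ht.1 hint
      (intervalIntegrable_const (c := 2 * ξ * flux b ξ φ w t)) fun r hr =>
        mul_le_mul_of_nonneg_left (hmono (hoc.out m0 ht hr) ht hr.2) (by positivity)
    rw [intervalIntegral.integral_const, smul_eq_mul, ← e, h0, norm_one] at h1
    nlinarith [sq_nonneg ‖φ t‖]

theorem energy_le_min (hab : Coefficients R a b) (hξ : 0 < ξ)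
    (h : ∀ T ∈ dom R, IntegralSolution a b T ξ φ w)
    (hanti : AntitoneOn (fun t => ‖φ t‖ ^ 2) (dom R)) (h0 : φ 0 = 1) {t : ℝ} (ht : t ∈ dom R) :
    energy R a b ξ φ t ≤ min (ENNReal.ofReal (-w 0).re) (2 / ENNReal.ofReal t) := by
  obtain ⟨b1, b2⟩ := flux_bounds hab hξ h h0 ht
  refine (energy_le_flux hab hξ h hanti ht).trans (le_min (ENNReal.ofReal_le_ofReal b1) ?_)
  rcases ht.1.eq_or_lt with e | hpos
  · rw [← e, ENNReal.ofReal_zero, ENNReal.div_zero two_ne_zero]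
    exact le_top
  · have : (2 : ENNReal) / ENNReal.ofReal t = ENNReal.ofReal (2 / t) := by
      rw [ENNReal.ofReal_div_of_pos hpos, ENNReal.ofReal_ofNat]
    rw [this]
    exact ENNReal.ofReal_le_ofReal ((le_div_iff₀ hpos).2 b2)

theorem integrableOn_deriv_tildePhi (ξ : ℝ) (φ : ℝ → ℂ)
    (h : energy R a b ξ φ 0 < ⊤) :
    IntegrableOn (fun t => ‖deriv (tildePhi b ξ φ) t‖ ^ 2) (dom R) := by
  have hset : dom R ∩ Ici 0 = dom R := inter_eq_left.2 fun t ht => ht.1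
  have hle : ∫⁻ s in dom R, ENNReal.ofReal (‖deriv (tildePhi b ξ φ) s‖ ^ 2) < ⊤ := by
    rw [energy, hset] at h
    exact lt_of_le_of_lt le_add_self h
  refine ⟨((measurable_deriv _).norm.pow_const 2).aestronglyMeasurable, ?_⟩
  rwa [hasFiniteIntegral_iff_ofReal (Eventually.of_forall fun s => sq_nonneg _)]

/-! ### The boundary condition at `R` -/

/-- A convex function lies below its chord, here from `1` at `0` to `0` at `T`. -/
theorem LocalCoeff.normSq_solK_truncK_le {α : Measure ℝ} {T : ℝ} (hb : LocalCoeff a α b T)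
    (hξ : 0 < ξ) (hT : 0 < T) {t : ℝ} (ht : t ∈ Icc 0 T) :
    ‖solK a b (truncK a b T ξ) ξ t‖ ^ 2 ≤ 1 - t / T := by
  have hξ' : 0 < (ξ : ℂ).re := by simpa using hξ
  have hsol := hb.integralSolution_solK (truncK a b T ξ) ξ
  have hconv : ConvexOn ℝ (Icc 0 T) fun t => ‖solK a b (truncK a b T ξ) ξ t‖ ^ 2 := by
    refine convexOn_of_sub_eq_integral (convex_Icc 0 T)
      (q := fun u => 2 * ξ * flux b ξ _ _ u) (fun s hs t ht hst => ?_)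
      fun s hs t ht _ => hsol.normSq_sub hb hξ hs ht
    exact mul_le_mul_of_nonneg_left (hsol.monotoneOn_flux hb hξ' hs ht hst) (by positivity)
  have h1 : 0 ≤ t / T := div_nonneg ht.1 hT.le
  have h2 : t / T ≤ 1 := div_le_one_of_le₀ ht.2 hT.le
  have := hconv.2 (⟨le_rfl, hT.le⟩ : (0 : ℝ) ∈ Icc 0 T) (⟨hT.le, le_rfl⟩ : T ∈ Icc 0 T)
    (sub_nonneg.2 h2) h1 (by ring)
  simp only [smul_eq_mul, mul_zero, zero_add, hb.solK_truncK hξ' hT, solK_zero, norm_one,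
    norm_zero] at this
  rw [div_mul_cancel₀ t hT.ne'] at this
  linarith

/-- There is a Rogers function `k` such that the solution with `φ(0) = 1` and `φ'(0) = -k(ξ)`
satisfies the boundary condition at `R`. -/
theorem exists_rogers (hab : Coefficients R a b) : ∃ k : ℂ → ℂ, IsRogers k ∧
    ∀ ξ : ℝ, 0 < ξ → VanishesOrBounded R (solK a b (k ξ) ξ) := by
  obtain ⟨τ, hmono, h1, h2⟩ := exists_exhaustion hab.R_pos
  have hb : ∀ n, LocalCoeff a (tildeA R a b) b (τ n) := fun n => hab.localCoeff (h1 n).2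
  have hone : 0 < ((1 : ℝ) : ℂ).re := by simp
  -- At `ξ = 1` the truncated solutions are bounded by `1` at the fixed point `τ 0`. There the
  -- solution with data `(0, 1)` is non-zero, so the equation can be solved for `k` with a uniform
  -- bound.
  obtain ⟨C, hC⟩ : ∃ C : ℝ, ∀ n, ‖truncK a b (τ n) ((1 : ℝ) : ℂ) / ((1 : ℝ) : ℂ)‖ ≤ C := by
    have hS := (hb 0).volterraSol_ne_zero hone (h1 0).1
    refine ⟨(1 + ‖volterraSol a b 1 0 ((1 : ℝ) : ℂ) (τ 0)‖) /
      ‖volterraSol a b 0 1 ((1 : ℝ) : ℂ) (τ 0)‖, fun n => ?_⟩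
    have hm : τ 0 ∈ Icc 0 (τ n) := ⟨(h1 0).1.le, hmono (Nat.zero_le n)⟩
    have h3 := (hb n).normSq_solK_truncK_le one_pos (h1 n).1 hm
    have h4 : ‖solK a b (truncK a b (τ n) ((1 : ℝ) : ℂ)) ((1 : ℝ) : ℂ) (τ 0)‖ ≤ 1 := by
      have : 0 ≤ τ 0 / τ n := div_nonneg hm.1 (h1 n).1.le
      nlinarith [norm_nonneg (solK a b (truncK a b (τ n) ((1 : ℝ) : ℂ)) ((1 : ℝ) : ℂ) (τ 0))]
    rw [Complex.ofReal_one, div_one, le_div_iff₀ (norm_pos_iff.2 (by simpa using hS)), ← norm_mul]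
    rw [Complex.ofReal_one] at h4
    have e : truncK a b (τ n) 1 * volterraSol a b 0 1 1 (τ 0) =
        volterraSol a b 1 0 1 (τ 0) - solK a b (truncK a b (τ n) 1) 1 (τ 0) := by
      rw [solK]
      ring
    rw [e]
    refine (norm_sub_le _ _).trans ?_
    linarith
  -- The same ultrafilter serves all `ξ` at once, so the limits form one holomorphic function.
  set 𝒰 : Ultrafilter ℕ := Ultrafilter.of atTop with h𝒰
  have hle : (𝒰 : Filter ℕ) ≤ atTop := Ultrafilter.of_le atTop
  obtain ⟨κ, hκd, hκre, hκ⟩ := exists_ultrafilter_limit_of_re_nonneg 𝒰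
    (h := fun n ξ => truncK a b (τ n) ξ / ξ) (fun n => (hb n).differentiableOn_truncK_div (h1 n).1)
    (fun n z hz => (hb n).re_truncK_div_nonneg hz (h1 n).1) hone hC
  have hne : ∀ z : ℂ, 0 < z.re → z ≠ 0 := fun z hz e => by simp [e] at hz
  refine ⟨fun z => z * κ z, ⟨differentiableOn_id.mul hκd, fun z hz => ?_⟩, fun ξ hξ => ?_⟩
  · rw [mul_div_cancel_left₀ _ (hne z hz)]
    exact hκre z hz
  have hξ' : 0 < (ξ : ℂ).re := by simpa using hξ
  have hlim : ∀ t, Tendsto (fun n => ‖solK a b (truncK a b (τ n) ξ) ξ t‖ ^ 2) 𝒰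
      (𝓝 (‖solK a b (ξ * κ ξ) ξ t‖ ^ 2)) := by
    intro t
    have hk : Tendsto (fun n => truncK a b (τ n) ξ) 𝒰 (𝓝 (ξ * κ ξ)) := by
      refine ((hκ ξ hξ').const_mul (ξ : ℂ)).congr fun n => ?_
      have := hne ξ hξ'
      field_simp
    exact (((hk.neg.mul_const _).const_add _).norm).pow 2
  have hbound : ∀ t ∈ dom R, ∀ q : ℝ, (∀ n, 1 - t / τ n ≤ q) →
      ‖solK a b (ξ * κ ξ) ξ t‖ ^ 2 ≤ q := by
    intro t ht q hq
    refine le_of_tendsto (hlim t) ?_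
    filter_upwards [hle (h2 t ht)] with n hn
    exact ((hb n).normSq_solK_truncK_le hξ (h1 n).1 ⟨ht.1, hn.le⟩).trans (hq n)
  refine ⟨fun _ => ⟨1, fun t ht => ?_⟩, fun r e => ?_⟩
  · have := hbound t ht 1 fun n => by
      have := div_nonneg ht.1 (h1 n).1.le
      linarith
    nlinarith [norm_nonneg (solK a b (ξ * κ ξ) ξ t)]
  · subst e
    have hr : 0 < r := by simpa using hab.R_pos
    -- Here `τ n < r`, so the chord bounds lie below `1 - t/r` uniformly in `n`, which forces the
    -- limit `0` at `r`.
    have hle' : ∀ᶠ t in 𝓝[<] r, ‖solK a b (ξ * κ ξ) ξ t‖ ^ 2 ≤ 1 - t / r := by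
      filter_upwards [eventually_mem_dom (zero_mem_dom hab.R_pos)] with t ht
      refine hbound t ht.1 _ fun n => ?_
      have h3 : τ n ≤ r := (EReal.coe_lt_coe_iff.1 (h1 n).2.2).le
      have := div_le_div_of_nonneg_left ht.1.1 (h1 n).1 h3
      linarith
    have h0 : Tendsto (fun t => 1 - t / r) (𝓝[<] r) (𝓝 0) := by
      have : Tendsto (fun t => 1 - t / r) (𝓝 r) (𝓝 (1 - r / r)) :=
        (tendsto_id.div_const r).const_sub 1
      rw [div_self hr.ne', sub_self] at this
      exact this.mono_left nhdsWithin_le_nhds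
    have hsq := squeeze_zero' (Eventually.of_forall fun t => sq_nonneg _) hle' h0
    have hn : Tendsto (fun t => ‖solK a b (ξ * κ ξ) ξ t‖) (𝓝[<] r) (𝓝 0) := by
      have := (Real.continuous_sqrt.tendsto 0).comp hsq
      rw [Real.sqrt_zero] at this
      refine this.congr fun t => ?_
      simp [Function.comp]
    exact tendsto_zero_iff_norm_tendsto_zero.2 hn

end RogersODE

/-! ### Assembly of the theorem -/

theorem theorem2p1 (R : EReal) (a : MeasureTheory.Measure ℝ) (b : ℝ → ℝ)
    (hab : RogersODE.Coefficients R a b) :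
    ∃ φ dφ : ℝ → ℝ → ℂ,
      -- (a) existence, uniqueness, and behaviour of the other solutions
      (∀ ξ : ℝ, 0 < ξ →
        RogersODE.IsPrincipalSolution R a b ξ (φ ξ) (dφ ξ) ∧
        (∀ ψ dψ : ℝ → ℂ, RogersODE.IsPrincipalSolution R a b ξ ψ dψ →
          Set.EqOn ψ (φ ξ) (RogersODE.dom R) ∧ Set.EqOn dψ (dφ ξ) (RogersODE.dom R)) ∧
        (∀ ψ dψ : ℝ → ℂ, RogersODE.IsSolution R a b ξ ψ dψ →
          (¬ ∃ c : ℂ, ∀ t ∈ RogersODE.dom R, ψ t = c * φ ξ t) →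
          RogersODE.DivergesOrAwayFromZero R ψ)) ∧
      -- (b) `k(ξ) = -φ_ξ'(0)` extends to a Rogers function
      (∃ k : ℂ → ℂ, RogersODE.IsRogers k ∧ ∀ ξ : ℝ, 0 < ξ → k ξ = -dφ ξ 0) ∧
      -- (c) monotonicity, convexity and the energy bound (with `2 / 0 = ∞`)
      (∀ ξ : ℝ, 0 < ξ →
        (∀ t ∈ RogersODE.dom R, 0 < ‖φ ξ t‖ ^ 2) ∧
        AntitoneOn (fun t => ‖φ ξ t‖ ^ 2) (RogersODE.dom R) ∧
        ConvexOn ℝ (RogersODE.dom R) (fun t => ‖φ ξ t‖ ^ 2) ∧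
        AntitoneOn (fun t => ‖dφ ξ t‖) (RogersODE.dom R) ∧
        (∀ t ∈ RogersODE.dom R,
          RogersODE.energy R a b ξ (φ ξ) t ≤
            min (ENNReal.ofReal (-dφ ξ 0).re) (2 / ENNReal.ofReal t)) ∧
        MeasureTheory.IntegrableOn
          (fun t => ‖deriv (RogersODE.tildePhi b ξ (φ ξ)) t‖ ^ 2) (RogersODE.dom R)) := by
  open RogersODE in
  obtain ⟨k, hk, hv⟩ := exists_rogers hab
  have hsol : ∀ ξ : ℝ, ∀ T ∈ dom R,
      IntegralSolution a b T ξ (solK a b (k ξ) ξ) (solKW a b (k ξ) ξ) := fun ξ T hT =>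
    (hab.localCoeff hT).integralSolution_solK _ _
  -- Subtracting `ψ(0) φ_ξ` leaves a solution that vanishes at `0` and satisfies the boundary
  -- condition, hence is zero. This yields uniqueness and also shows that only multiples of `φ_ξ`
  -- can satisfy the boundary condition.
  have hdiff : ∀ ξ : ℝ, 0 < ξ → ∀ ψ dψ : ℝ → ℂ, IsSolution R a b ξ ψ dψ →
      VanishesOrBounded R ψ → (∀ t ∈ dom R, ψ t + -ψ 0 * solK a b (k ξ) ξ t = 0) ∧
        ∀ t ∈ dom R, expB b (2 * Complex.I * ξ) t * dψ t + -ψ 0 * solKW a b (k ξ) ξ t = 0 :=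
    fun ξ hξ ψ dψ h hψ => eq_zero_of_vanishesOrBounded hab hξ
      (fun T hT => (h.integralSolution hab hT).add_const_mul (hab.localCoeff hT) (hsol ξ T hT) _)
      (hψ.add_const_mul (hv ξ hξ) _) (by simp [solK_zero])
  refine ⟨fun ξ => solK a b (k ξ) ξ,
    fun ξ t => expB b (-(2 * Complex.I * ξ)) t * solKW a b (k ξ) ξ t, fun ξ hξ => ⟨?_, ?_, ?_⟩,
    ⟨k, hk, fun ξ _ => ?_⟩, fun ξ hξ => ?_⟩
  · exact ⟨isSolution_of_integralSolution hab hξ.ne' (hsol ξ), solK_zero _ _, hv ξ hξ⟩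
  · rintro ψ dψ ⟨h, h0, hψ⟩
    obtain ⟨e1, e2⟩ := hdiff ξ hξ ψ dψ h hψ
    refine ⟨fun t ht => ?_, fun t ht => ?_⟩
    · linear_combination e1 t ht + (solK a b (k ξ) ξ t) * h0
    · have e3 : expB b (2 * Complex.I * ξ) t * dψ t = solKW a b (k ξ) ξ t := by
        linear_combination e2 t ht + (solKW a b (k ξ) ξ t) * h0
      simp only [← e3, expB_neg_mul_cancel]
  · intro ψ dψ h hne
    refine (divergesOrAwayFromZero_or_vanishesOrBounded hab.R_pos
      (convexOn_normSq hab hξ fun T hT => h.integralSolution hab hT)).resolve_right fun hψ => ?_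
    refine hne ⟨ψ 0, fun t ht => ?_⟩
    linear_combination (hdiff ξ hξ ψ dψ h hψ).1 t ht
  · simp [expB_zero_right, solKW_zero]
  · have hconv := convexOn_normSq hab hξ (hsol ξ)
    have hanti := antitoneOn_of_vanishesOrBounded hab.R_pos hconv (hv ξ hξ)
    have hen : ∀ t ∈ dom R, energy R a b ξ (solK a b (k ξ) ξ) t ≤
        min (ENNReal.ofReal (-(expB b (-(2 * Complex.I * ξ)) 0 * solKW a b (k ξ) ξ 0)).re)
          (2 / ENNReal.ofReal t) := fun t ht => by
      rw [expB_zero_right, one_mul]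
      exact energy_le_min hab hξ (hsol ξ) hanti (solK_zero _ _) ht
    refine ⟨fun t ht => ?_, hanti, hconv, antitoneOn_norm_deriv hab hξ (hsol ξ) hanti, hen, ?_⟩
    · have := norm_pos_iff.2 (solK_ne_zero hab hanti ht)
      positivity
    · exact integrableOn_deriv_tildePhi ξ _ ((hen 0 (zero_mem_dom hab.R_pos)).trans_lt
        ((min_le_left _ _).trans_lt ENNReal.ofReal_lt_top))
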